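/- Let $X=[\underline x,\overline x]$, $Z=[\underline z_-,\overline z_-]\cup[\underline z_+,\overline z_+]$ be subsets of $\mathbb R$ and $Y\subset\mathbb R$ a compact set, and let $\mu_X,\mu_Y,\mu_Z$ be Borel probability measures concentrated on $X,Y,Z$ respectively, in convex order $\mu_X\preceq_c\mu_Y\preceq_c\mu_Z$, i.e. $\int\varphi\,d\mu_X\le\int\varphi\,d\mu_Y\le\int\varphi\,d\mu_Z$ for every convex $\varphi:\mathbb R\to\mathbb R$. Suppose that $\mu_X$ is non-atomic, that $\mu_Y=a_1\delta_{y_1}+a_2\delta_{y_2}$ with $a_1,a_2\ge 0$ and $y_1,y_2\in Y$, and that $\overline z_-<y_1<y_2<\underline z_+$. Let $c(x,y,z)=c_1(x,y)+c_2(y,z)+c_3(x,z)$ with $c_1,c_2,c_3$ continuous on $X\times Y$, $Y\times Z$, $X\times Z$ respectively. Suppose that the partial derivative $\partial_x c_3(x,z)$ exists for all $(x,z)\in X\times Z$ (one-sided at the end points of $X$) and that $c_3$ satisfies the martingale Spence–Mirrlees condition: for each $x\in X$ the function $g=\partial_x c_3(x,\cdot)$ is strictly concave on $Z$, in the sense that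 $(1-t)g(z_0)+t\,g(z_1)<g((1-t)z_0+tz_1)$ whenever $t\in(0,1)$, $z_0\ne z_1$, and $z_0,\,z_1,\,(1-t)z_0+tz_1\in Z$. Let $\Pi_M(\mu_X,\mu_Y,\mu_Z)$ be the set of Borel probability measures $\pi$ on $\mathbb R^3$ with marginals $\mu_X,\mu_Y,\mu_Z$ such that, for the conditional laws under $\pi$, $\int y\,\pi(dy\,dz\mid x)=x$ for $\mu_X$-a.e. $x$ and $\int z\,\pi(dz\mid x,y)=y$ for a.e. $(x,y)$ with respect to the $(x,y)$-marginal of $\pi$. Then the three-period martingale optimal transport problem $$\inf_{\pi\in\Pi_M(\mu_X,\mu_Y,\mu_Z)}\int c(x,y,z)\,d\pi(x,y,z)$$ has exactly one optimal solution: there is one and only one $\pi\in\Pi_M(\mu_X,\mu_Y,\mu_Z)$ that attains the infimum. -/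

import Mathlib

open MeasureTheory ProbabilityTheory Set

open scoped NNReal

/-- Convex order `μ ⪯_c ν` on the real line. It is only used for compactly supported probability
measures, for which every convex function `ℝ → ℝ` is integrable. -/
def ConvexOrder (μ ν : Measure ℝ) : Prop :=
  ∀ φ : ℝ → ℝ, ConvexOn ℝ univ φ → ∫ x, φ x ∂μ ≤ ∫ x, φ x ∂ν

/-- The couplings `Π(μ_X, μ_Y, μ_Z)`: laws of triples `(x, y, z)` with the given marginals. -/
def Couplings (μX μY μZ : Measure ℝ) : Set (ProbabilityMeasure (ℝ × ℝ × ℝ)) :=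
  {π | (π : Measure (ℝ × ℝ × ℝ)).map (fun p => p.1) = μX ∧
       (π : Measure (ℝ × ℝ × ℝ)).map (fun p => p.2.1) = μY ∧
       (π : Measure (ℝ × ℝ × ℝ)).map (fun p => p.2.2) = μZ}

/-- The law `π` regrouped as a measure on pairs `((x, y), z)`. -/
noncomputable def regroup (π : ProbabilityMeasure (ℝ × ℝ × ℝ)) : Measure ((ℝ × ℝ) × ℝ) :=
  (π : Measure (ℝ × ℝ × ℝ)).map (fun p => ((p.1, p.2.1), p.2.2))

instance (π : ProbabilityMeasure (ℝ × ℝ × ℝ)) : IsFiniteMeasure (regroup π) := by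
  unfold regroup; infer_instance

/-- The martingale couplings `Π_M(μ_X, μ_Y, μ_Z)`. Writing `π = π_X ⊗ κ` for the disintegration of
`π` with respect to `x`, the barycenter of `y` under `κ(x, dy dz)` is `x`; writing
`π = π_{XY} ⊗ κ'` for the disintegration with respect to `(x, y)`, the barycenter of `κ'(x, y, dz)`
is `y` (almost everywhere). -/
def MartingaleCouplings (μX μY μZ : Measure ℝ) : Set (ProbabilityMeasure (ℝ × ℝ × ℝ)) :=
  {π | π ∈ Couplings μX μY μZ ∧
       (∀ᵐ x ∂(π : Measure (ℝ × ℝ × ℝ)).fst,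
          ∫ q, q.1 ∂((π : Measure (ℝ × ℝ × ℝ)).condKernel x) = x) ∧
       (∀ᵐ p ∂(regroup π).fst, ∫ z, z ∂((regroup π).condKernel p) = p.2)}

/-- `π` is an optimal solution of the three-period martingale optimal transport problem
`inf { ∫ c dπ : π ∈ Π_M(μ_X, μ_Y, μ_Z) }`. -/
def IsOptimalMOT (c : ℝ → ℝ → ℝ → ℝ) (μX μY μZ : Measure ℝ)
    (π : ProbabilityMeasure (ℝ × ℝ × ℝ)) : Prop :=
  π ∈ MartingaleCouplings μX μY μZ ∧
  ∀ π' ∈ MartingaleCouplings μX μY μZ,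
    ∫ p, c p.1 p.2.1 p.2.2 ∂(π : Measure (ℝ × ℝ × ℝ)) ≤
      ∫ p, c p.1 p.2.1 p.2.2 ∂(π' : Measure (ℝ × ℝ × ℝ))

/-- Strict concavity of a function on a set `S ⊆ ℝ` that need not be convex: the strict concavity
inequality holds whenever the two end points and the convex combination all lie in `S`. -/
def StrictlyConcaveOn (S : Set ℝ) (f : ℝ → ℝ) : Prop :=
  ∀ z₀ ∈ S, ∀ z₁ ∈ S, z₀ ≠ z₁ → ∀ t : ℝ, 0 < t → t < 1 → (1 - t) * z₀ + t * z₁ ∈ S →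
    (1 - t) * f z₀ + t * f z₁ < f ((1 - t) * z₀ + t * z₁)

/-- The martingale Spence–Mirrlees condition on `X × Z`, with `X` an interval: the partial
derivative `∂_x c(x, z)` exists (one-sided at the end points of `X`) and is strictly concave in
`z ∈ Z` for each `x ∈ X`. -/
def MartingaleSpenceMirrlees (X Z : Set ℝ) (c : ℝ → ℝ → ℝ) : Prop :=
  (∀ z ∈ Z, DifferentiableOn ℝ (fun x => c x z) X) ∧
  ∀ x ∈ X, StrictlyConcaveOn Z (fun z => derivWithin (fun t => c t z) X x)

/-! Uniqueness. Since `y` takes only two values, the first martingale constraint forces the weights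
`(y₂ - x) / (y₂ - y₁)` and `(x - y₁) / (y₂ - y₁)` of `y₁` and `y₂` given `x`, so all couplings share
the law of `(x, y)` (`regroup_fst_eq`) and only the conditional law of `z` is free. Let `x < x'`
share the same `y`, with `x` sending mass to `z₀` and `z₁` and `x'` sending mass to `z'`, where `z₀
< z' < z₁`. A swap preserving barycenters respects all constraints, and by Spence–Mirrlees it
strictly lowers the cost. An optimal coupling therefore gives such configurations measure zero
(`setIntegral_exchange_nonneg`). At fixed `y`, two different `x` cannot then both send mass to three
separated places; as `μX` has no atoms, almost every conditional law of `z` has at most two points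
(`ae_exists_pair_of_optimal`). The midpoint of two optimal couplings is optimal, so it has two-point
conditional laws. Those of the two original couplings are carried by the same pairs and have the
same mean `y`, hence coincide (`eq_of_optimal`).

Existence. Convex order places `μX` on `[y₁, y₂]`, and the gap in `Z` allows `μZ` to be split into
laws with means `y₁` and `y₂`; gluing them gives a martingale coupling. The set of martingale
couplings is weakly compact and the cost is continuous on it (`exists_optimal`). -/

/-! ### Martingale constraints as integral identities. -/

theorem Continuous.integrable_of_ae_mem_isCompact {α : Type*} [TopologicalSpace α]
    [MeasurableSpace α] [BorelSpace α] [T2Space α]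
    {μ : Measure α} [IsFiniteMeasure μ] {K : Set α} (hK : IsCompact K) (h : ∀ᵐ x ∂μ, x ∈ K)
    {f : α → ℝ} (hf : Continuous f) : Integrable f μ := by
  have h1 : μ.restrict K = μ := Measure.restrict_eq_self_of_ae_mem h
  have h2 := hf.continuousOn.integrableOn_compact (μ := μ) hK
  rwa [IntegrableOn, h1] at h2

/-- The barycenter of a disintegration, tested against continuous functions. -/
theorem ae_condKernel_integral_eq_iff {E Ω : Type*}
    [NormedAddCommGroup E] [NormedSpace ℝ E] [FiniteDimensional ℝ E] [MeasurableSpace E]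
    [BorelSpace E]
    [TopologicalSpace Ω] [MeasurableSpace Ω] [BorelSpace Ω] [StandardBorelSpace Ω] [Nonempty Ω]
    [T2Space Ω] [SecondCountableTopology Ω]
    (ν : Measure (E × Ω)) [IsFiniteMeasure ν] {K : Set (E × Ω)} (hK : IsCompact K)
    (hν : ∀ᵐ p ∂ν, p ∈ K) {f : Ω → ℝ} (hf : Continuous f) {r : E → ℝ} (hr : Continuous r) :
    (∀ᵐ x ∂ν.fst, ∫ q, f q ∂(ν.condKernel x) = r x) ↔
      ∀ g : E → ℝ, Continuous g → ∫ p, g p.1 * (f p.2 - r p.1) ∂ν = 0 := by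
  have hdis : ν.fst ⊗ₘ ν.condKernel = ν := ν.disintegrate ν.condKernel
  have key : ∀ g : E → ℝ, Continuous g → ∫ p, g p.1 * (f p.2 - r p.1) ∂ν =
      ∫ x, g x * (∫ q, (f q - r x) ∂(ν.condKernel x)) ∂ν.fst := by
    intro g hg
    have hi : Integrable (fun p : E × Ω => g p.1 * (f p.2 - r p.1)) (ν.fst ⊗ₘ ν.condKernel) := by
      rw [hdis]
      exact Continuous.integrable_of_ae_mem_isCompact hK hν (by fun_prop)
    have := Measure.integral_compProd hi
    rw [hdis] at this
    rw [this]
    simp only [integral_const_mul]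
  have hi1 : Integrable (fun p : E × Ω => f p.2) (ν.fst ⊗ₘ ν.condKernel) := by
    rw [hdis]
    exact Continuous.integrable_of_ae_mem_isCompact hK hν (by fun_prop)
  have hi2 : Integrable (fun p : E × Ω => f p.2 - r p.1) (ν.fst ⊗ₘ ν.condKernel) := by
    rw [hdis]
    exact Continuous.integrable_of_ae_mem_isCompact hK hν (by fun_prop)
  have hsub : ∀ᵐ x ∂ν.fst, ∫ q, (f q - r x) ∂(ν.condKernel x)
      = ∫ q, f q ∂(ν.condKernel x) - r x := by
    have h3 := ((Measure.integrable_compProd_iff hi1.aestronglyMeasurable).1 hi1).1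
    filter_upwards [h3] with x hx
    rw [integral_sub hx (integrable_const _)]
    simp
  constructor
  · intro h g hg
    rw [key g hg]
    apply integral_eq_zero_of_ae
    filter_upwards [h, hsub] with x h1 h2
    rw [h2, h1]
    simp
  · intro h
    have hm : Integrable (fun x => ∫ q, (f q - r x) ∂(ν.condKernel x)) ν.fst :=
      MeasureTheory.Integrable.integral_compProd hi2
    -- Fundamental lemma of the calculus of variations: orthogonality to compactly supported smooth
    -- functions suffices.
    have h0 := ae_eq_zero_of_integral_contDiff_smul_eq_zero (μ := ν.fst) hm.locallyIntegrable
      (fun g hg _ => by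
        have := key g hg.continuous
        rw [h g hg.continuous] at this
        simpa using this.symm)
    filter_upwards [h0, hsub] with x h1 h2
    linarith

/-- The two martingale constraints, tested against continuous functions. -/
def MartingaleTests (π : Measure (ℝ × ℝ × ℝ)) : Prop :=
  (∀ g : ℝ → ℝ, Continuous g → ∫ p, g p.1 * (p.2.1 - p.1) ∂π = 0) ∧
  ∀ g : ℝ × ℝ → ℝ, Continuous g → ∫ p, g (p.1, p.2.1) * (p.2.2 - p.2.1) ∂π = 0

theorem ae_mem_prod_of_map {ν : Measure (ℝ × ℝ × ℝ)} {X Y Z : Set ℝ} (hX : MeasurableSet X)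
    (hY : MeasurableSet Y) (hZ : MeasurableSet Z)
    (h1 : ν.map (fun p => p.1) Xᶜ = 0) (h2 : ν.map (fun p => p.2.1) Yᶜ = 0)
    (h3 : ν.map (fun p => p.2.2) Zᶜ = 0) : ∀ᵐ p ∂ν, p ∈ X ×ˢ Y ×ˢ Z := by
  rw [Measure.map_apply (by fun_prop) hX.compl] at h1
  rw [Measure.map_apply (by fun_prop) hY.compl] at h2
  rw [Measure.map_apply (by fun_prop) hZ.compl] at h3
  have e1 : ∀ᵐ p ∂ν, p.1 ∈ X := h1
  have e2 : ∀ᵐ p ∂ν, p.2.1 ∈ Y := h2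
  have e3 : ∀ᵐ p ∂ν, p.2.2 ∈ Z := h3
  filter_upwards [e1, e2, e3] with p q1 q2 q3 using ⟨q1, q2, q3⟩

theorem Couplings.ae_mem {μX μY μZ : Measure ℝ} {π : ProbabilityMeasure (ℝ × ℝ × ℝ)}
    (h : π ∈ Couplings μX μY μZ) {X Y Z : Set ℝ} (hX : MeasurableSet X) (hY : MeasurableSet Y)
    (hZ : MeasurableSet Z) (hμX : μX Xᶜ = 0) (hμY : μY Yᶜ = 0) (hμZ : μZ Zᶜ = 0) :
    ∀ᵐ p ∂(π : Measure (ℝ × ℝ × ℝ)), p ∈ X ×ˢ Y ×ˢ Z := by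
  exact ae_mem_prod_of_map hX hY hZ (by rwa [h.1]) (by rwa [h.2.1]) (by rwa [h.2.2])

/-- The tested form is linear in `π` and closed under weak limits of couplings; exchanges, averages
and compactness all rely on this. -/
theorem mem_martingaleCouplings_iff {μX μY μZ : Measure ℝ} {X Y Z : Set ℝ} (hX : IsCompact X)
    (hY : IsCompact Y) (hZ : IsCompact Z) (hμX : μX Xᶜ = 0) (hμY : μY Yᶜ = 0) (hμZ : μZ Zᶜ = 0)
    (π : ProbabilityMeasure (ℝ × ℝ × ℝ)) :
    π ∈ MartingaleCouplings μX μY μZ ↔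
      π ∈ Couplings μX μY μZ ∧ MartingaleTests (π : Measure (ℝ × ℝ × ℝ)) := by
  refine and_congr_right fun hπ => ?_
  have hae := Couplings.ae_mem hπ hX.measurableSet hY.measurableSet hZ.measurableSet hμX hμY hμZ
  have hK : IsCompact ((X ×ˢ Y) ×ˢ Z) := (hX.prod hY).prod hZ
  have hm : Measurable (fun p : ℝ × ℝ × ℝ => ((p.1, p.2.1), p.2.2)) := by fun_prop
  have hae' : ∀ᵐ q ∂(regroup π), q ∈ (X ×ˢ Y) ×ˢ Z := by
    rw [regroup, ae_map_iff (p := fun q => q ∈ (X ×ˢ Y) ×ˢ Z) hm.aemeasurable hK.measurableSet]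
    filter_upwards [hae] with p hp using ⟨⟨hp.1, hp.2.1⟩, hp.2.2⟩
  refine and_congr ?_ ?_
  · exact ae_condKernel_integral_eq_iff (π : Measure (ℝ × ℝ × ℝ)) (hX.prod (hY.prod hZ)) hae
      (f := fun q => q.1) continuous_fst (r := fun x => x) continuous_id
  · rw [ae_condKernel_integral_eq_iff (regroup π) hK hae' (f := fun q => q) continuous_id
      (r := fun p => p.2) continuous_snd]
    refine forall_congr' fun g => forall_congr' fun hg => ?_
    rw [regroup, integral_map hm.aemeasurable]
    exact (by fun_prop : Continuous fun p : (ℝ × ℝ) × ℝ => g p.1 * (p.2 - p.1.2)).aestronglyMeasurable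

/-! ### Exchange of mass and first-order optimality. -/

/-- Replacing a part `N` of a martingale coupling `π` by a measure `Q` with the same `(x, y)` and
`z` marginals and the same first moments in `z` yields a martingale coupling. -/
theorem exists_coupling_of_exchange {μX μY μZ : Measure ℝ} {X Y Z : Set ℝ} (hX : IsCompact X)
    (hY : IsCompact Y) (hZ : IsCompact Z) (hμX : μX Xᶜ = 0) (hμY : μY Yᶜ = 0) (hμZ : μZ Zᶜ = 0)
    {π : ProbabilityMeasure (ℝ × ℝ × ℝ)} (hπ : π ∈ Couplings μX μY μZ)
    (hM : MartingaleTests (π : Measure (ℝ × ℝ × ℝ)))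
    {N Q : Measure (ℝ × ℝ × ℝ)} [IsFiniteMeasure N] [IsFiniteMeasure Q]
    (hN : N ≤ (π : Measure (ℝ × ℝ × ℝ)))
    (hxy : N.map (fun p => (p.1, p.2.1)) = Q.map (fun p => (p.1, p.2.1)))
    (hz : N.map (fun p => p.2.2) = Q.map (fun p => p.2.2))
    (hm : ∀ g : ℝ × ℝ → ℝ, Continuous g → ∫ p, g (p.1, p.2.1) * (p.2.2 - p.2.1) ∂N =
      ∫ p, g (p.1, p.2.1) * (p.2.2 - p.2.1) ∂Q) :
    ∃ π' : ProbabilityMeasure (ℝ × ℝ × ℝ), π' ∈ Couplings μX μY μZ ∧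
      MartingaleTests (π' : Measure (ℝ × ℝ × ℝ)) ∧
      ∀ h : ℝ × ℝ × ℝ → ℝ, Continuous h →
        ∫ p, h p ∂(π' : Measure (ℝ × ℝ × ℝ)) + ∫ p, h p ∂N =
          ∫ p, h p ∂(π : Measure (ℝ × ℝ × ℝ)) + ∫ p, h p ∂Q := by
  have hK : IsCompact (X ×ˢ Y ×ˢ Z) := hX.prod (hY.prod hZ)
  have haeπ := Couplings.ae_mem hπ hX.measurableSet hY.measurableSet hZ.measurableSet hμX hμY hμZ
  have haeN : ∀ᵐ p ∂N, p ∈ X ×ˢ Y ×ˢ Z := (Measure.absolutelyContinuous_of_le hN).ae_le haeπ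
  have hx : N.map (fun p => p.1) = Q.map (fun p => p.1) := by
    have := congrArg (fun m => m.map Prod.fst) hxy
    rwa [Measure.map_map measurable_fst (by fun_prop),
      Measure.map_map measurable_fst (by fun_prop)] at this
  have hy : N.map (fun p => p.2.1) = Q.map (fun p => p.2.1) := by
    have := congrArg (fun m => m.map Prod.snd) hxy
    rwa [Measure.map_map measurable_snd (by fun_prop),
      Measure.map_map measurable_snd (by fun_prop)] at this
  have hle : ∀ f : ℝ × ℝ × ℝ → ℝ, Measurable f → ∀ S : Set ℝ, MeasurableSet S →
      (π : Measure (ℝ × ℝ × ℝ)).map f S = 0 → N.map f S = 0 := by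
    intro f hf S hS h
    exact le_antisymm ((Measure.map_mono hN hf S).trans h.le) (zero_le)
  have haeQ : ∀ᵐ p ∂Q, p ∈ X ×ˢ Y ×ˢ Z := by
    refine ae_mem_prod_of_map hX.measurableSet hY.measurableSet hZ.measurableSet ?_ ?_ ?_
    · rw [← hx]
      exact hle _ (by fun_prop) _ hX.measurableSet.compl (by rw [hπ.1]; exact hμX)
    · rw [← hy]
      exact hle _ (by fun_prop) _ hY.measurableSet.compl (by rw [hπ.2.1]; exact hμY)
    · rw [← hz]
      exact hle _ (by fun_prop) _ hZ.measurableSet.compl (by rw [hπ.2.2]; exact hμZ)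
  -- The competitor is `π - N + Q`; the subtraction is genuine because `N ≤ π`.
  set ν : Measure (ℝ × ℝ × ℝ) := (π : Measure (ℝ × ℝ × ℝ)) - N with hν
  have hνN : ν + N = (π : Measure (ℝ × ℝ × ℝ)) := Measure.sub_add_cancel_of_le hN
  have hνπ : ν ≤ (π : Measure (ℝ × ℝ × ℝ)) := Measure.sub_le
  have haeν : ∀ᵐ p ∂ν, p ∈ X ×ˢ Y ×ˢ Z := (Measure.absolutelyContinuous_of_le hνπ).ae_le haeπ
  have : IsFiniteMeasure ν := isFiniteMeasure_of_le _ hνπ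
  have hmap : ∀ f : ℝ × ℝ × ℝ → ℝ, Measurable f → N.map f = Q.map f →
      (ν + Q).map f = (π : Measure (ℝ × ℝ × ℝ)).map f := by
    intro f hf h
    rw [Measure.map_add _ _ hf, ← h, ← Measure.map_add _ _ hf, hνN]
  have hprob : IsProbabilityMeasure (ν + Q) := by
    constructor
    have h1 := congrArg (fun m => m univ) (hmap (fun p => p.1) (by fun_prop) hx)
    simp only [Measure.map_apply (measurable_fst : Measurable fun p : ℝ × ℝ × ℝ => p.1)
      MeasurableSet.univ, preimage_univ, measure_univ] at h1
    exact h1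
  have hint : ∀ h : ℝ × ℝ × ℝ → ℝ, Continuous h →
      ∫ p, h p ∂(ν + Q) + ∫ p, h p ∂N = ∫ p, h p ∂(π : Measure (ℝ × ℝ × ℝ)) + ∫ p, h p ∂Q := by
    intro h hh
    rw [← hνN, integral_add_measure (hh.integrable_of_ae_mem_isCompact hK haeν)
      (hh.integrable_of_ae_mem_isCompact hK haeQ),
      integral_add_measure (hh.integrable_of_ae_mem_isCompact hK haeν)
      (hh.integrable_of_ae_mem_isCompact hK haeN)]
    ring
  refine ⟨⟨ν + Q, hprob⟩, ⟨?_, ?_, ?_⟩, ⟨?_, ?_⟩, hint⟩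
  · exact (hmap _ (by fun_prop) hx).trans hπ.1
  · exact (hmap _ (by fun_prop) hy).trans hπ.2.1
  · exact (hmap _ (by fun_prop) hz).trans hπ.2.2
  · intro g hg
    have h1 := hint (fun p => g p.1 * (p.2.1 - p.1)) (by fun_prop)
    rw [hM.1 g hg] at h1
    have h2 : ∫ p, g p.1 * (p.2.1 - p.1) ∂N = ∫ p, g p.1 * (p.2.1 - p.1) ∂Q := by
      have hmp : Measurable (fun p : ℝ × ℝ × ℝ => (p.1, p.2.1)) := by fun_prop
      have hs : ∀ m : Measure (ℝ × ℝ), AEStronglyMeasurable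
        (fun q : ℝ × ℝ => g q.1 * (q.2 - q.1)) m := fun m =>
          (by fun_prop : Continuous fun q : ℝ × ℝ => g q.1 * (q.2 - q.1)).aestronglyMeasurable
      have := congrArg (fun m => ∫ q, g q.1 * (q.2 - q.1) ∂m) hxy
      simpa only [integral_map hmp.aemeasurable (hs _)] using this
    change ∫ p, g p.1 * (p.2.1 - p.1) ∂(ν + Q) = 0
    linarith
  · intro g hg
    have h1 := hint (fun p => g (p.1, p.2.1) * (p.2.2 - p.2.1)) (by fun_prop)
    rw [hM.2 g hg, hm g hg] at h1
    change ∫ p, g (p.1, p.2.1) * (p.2.2 - p.2.1) ∂(ν + Q) = 0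
    linarith

theorem integral_map_restrict_withDensity_ofReal {α β : Type*} [MeasurableSpace α]
    [MeasurableSpace β] {μ : Measure α} {E : Set α} (hE : MeasurableSet E) {w : α → ℝ}
    (hw : Measurable w) (hw0 : ∀ a ∈ E, 0 ≤ w a) {f : α → β} (hf : Measurable f) {F : β → ℝ}
    (hF : Measurable F) :
    ∫ b, F b ∂(((μ.restrict E).withDensity fun a => ENNReal.ofReal (w a)).map f) =
      ∫ a in E, w a * F (f a) ∂μ := by
  rw [integral_map hf.aemeasurable hF.aestronglyMeasurable,
    integral_withDensity_eq_integral_toReal_smul (by fun_prop) (by simp)]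
  refine setIntegral_congr_fun hE fun a ha => ?_
  simp [ENNReal.toReal_ofReal (hw0 a ha)]

theorem map_restrict_withDensity_ofReal_le {α β : Type*} [MeasurableSpace α]
    [MeasurableSpace β] {μ : Measure α} {E : Set α} {w : α → ℝ} {r : ℝ≥0}
    (hw : ∀ᵐ a ∂μ, w a ≤ r) {f : α → β} (hf : Measurable f) :
    ((μ.restrict E).withDensity fun a => ENNReal.ofReal (w a)).map f ≤ r • μ.map f := by
  rw [← Measure.map_smul]
  refine Measure.map_mono ?_ hf
  calc (μ.restrict E).withDensity (fun a => ENNReal.ofReal (w a))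
      ≤ (μ.restrict E).withDensity (fun _ => (r : ENNReal)) := by
        refine withDensity_mono ?_
        filter_upwards [ae_restrict_of_ae hw] with a ha
        rw [← ENNReal.ofReal_coe_nnreal]
        exact ENNReal.ofReal_le_ofReal ha
    _ = r • μ.restrict E := withDensity_const _
    _ ≤ r • μ := by
        gcongr
        exact Measure.restrict_le_self

/-- First-order optimality for exchanging, between two starting points `(x, y)` and `(x', y')`, the
mass sent to `z'` with the mass sent to `z₀` and `z₁`, where `z₀ < z' < z₁`. The law `Θ` is a law of
`(((x, y), (z₀, z₁)), ((x', y'), z'))`. -/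
theorem setIntegral_exchange_nonneg {μX μY μZ : Measure ℝ} {X Y Z : Set ℝ} (hX : IsCompact X)
    (hY : IsCompact Y) (hZ : IsCompact Z) (hμX : μX Xᶜ = 0) (hμY : μY Yᶜ = 0) (hμZ : μZ Zᶜ = 0)
    {π : ProbabilityMeasure (ℝ × ℝ × ℝ)} (hπ : π ∈ Couplings μX μY μZ)
    (hM : MartingaleTests (π : Measure (ℝ × ℝ × ℝ)))
    {C : ℝ × ℝ × ℝ → ℝ} (hC : Continuous C)
    (hopt : ∀ π' ∈ Couplings μX μY μZ, MartingaleTests (π' : Measure (ℝ × ℝ × ℝ)) →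
      ∫ p, C p ∂(π : Measure (ℝ × ℝ × ℝ)) ≤ ∫ p, C p ∂(π' : Measure (ℝ × ℝ × ℝ)))
    (Θ : Measure (((ℝ × ℝ) × (ℝ × ℝ)) × ((ℝ × ℝ) × ℝ))) [IsFiniteMeasure Θ]
    (h0 : Θ.map (fun τ => (τ.1.1.1, τ.1.1.2, τ.1.2.1)) = π)
    (h1 : Θ.map (fun τ => (τ.1.1.1, τ.1.1.2, τ.1.2.2)) = π)
    (h2 : Θ.map (fun τ => (τ.2.1.1, τ.2.1.2, τ.2.2)) = π)
    {E : Set (((ℝ × ℝ) × (ℝ × ℝ)) × ((ℝ × ℝ) × ℝ))} (hE : MeasurableSet E)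
    (hlt : ∀ τ ∈ E, τ.1.2.1 < τ.2.2 ∧ τ.2.2 < τ.1.2.2) :
    0 ≤ ∫ τ in E, ((τ.1.2.2 - τ.1.2.1) *
          (C (τ.1.1.1, τ.1.1.2, τ.2.2) - C (τ.2.1.1, τ.2.1.2, τ.2.2))
        + (τ.1.2.2 - τ.2.2) *
          (C (τ.2.1.1, τ.2.1.2, τ.1.2.1) - C (τ.1.1.1, τ.1.1.2, τ.1.2.1))
        + (τ.2.2 - τ.1.2.1) *
          (C (τ.2.1.1, τ.2.1.2, τ.1.2.2) - C (τ.1.1.1, τ.1.1.2, τ.1.2.2))) ∂Θ := by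
  have hK : IsCompact (X ×ˢ Y ×ˢ Z) := hX.prod (hY.prod hZ)
  have haeπ := Couplings.ae_mem hπ hX.measurableSet hY.measurableSet hZ.measurableSet hμX hμY hμZ
  have hKT : IsCompact (((X ×ˢ Y) ×ˢ (Z ×ˢ Z)) ×ˢ ((X ×ˢ Y) ×ˢ Z)) :=
    ((hX.prod hY).prod (hZ.prod hZ)).prod ((hX.prod hY).prod hZ)
  have k0 := ae_of_ae_map (f := fun τ : ((ℝ × ℝ) × (ℝ × ℝ)) × ((ℝ × ℝ) × ℝ) =>
    (τ.1.1.1, τ.1.1.2, τ.1.2.1)) (μ := Θ) (by fun_prop) (by rw [h0]; exact haeπ)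
  have k1 := ae_of_ae_map (f := fun τ : ((ℝ × ℝ) × (ℝ × ℝ)) × ((ℝ × ℝ) × ℝ) =>
    (τ.1.1.1, τ.1.1.2, τ.1.2.2)) (μ := Θ) (by fun_prop) (by rw [h1]; exact haeπ)
  have k2 := ae_of_ae_map (f := fun τ : ((ℝ × ℝ) × (ℝ × ℝ)) × ((ℝ × ℝ) × ℝ) =>
    (τ.2.1.1, τ.2.1.2, τ.2.2)) (μ := Θ) (by fun_prop) (by rw [h2]; exact haeπ)
  have hΘ : ∀ᵐ τ ∂Θ, τ ∈ ((X ×ˢ Y) ×ˢ (Z ×ˢ Z)) ×ˢ ((X ×ˢ Y) ×ˢ Z) := by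
    filter_upwards [k0, k1, k2] with τ q0 q1 q2
    exact ⟨⟨⟨q0.1, q0.2.1⟩, ⟨q0.2.2, q1.2.2⟩⟩, ⟨⟨q2.1, q2.2.1⟩, q2.2.2⟩⟩
  obtain ⟨R, hR0, hR⟩ : ∃ R > 0, ∀ z ∈ Z, |z| ≤ R := by
    obtain ⟨R, hR⟩ := hZ.isBounded.exists_norm_le
    exact ⟨max R 1, by positivity, fun z hz => (hR z hz).trans (le_max_left _ _)⟩
  -- Differences of points of `Z` are at most `2 * R`, so `ε = 1 / (6 * R)` keeps each weight below
  -- `1/3`, and the three removed pieces together stay below `π`.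
  obtain ⟨ε, hε0, hε⟩ : ∃ ε > 0, ∀ a ∈ Z, ∀ b ∈ Z, ε * (a - b) ≤ ((3⁻¹ : ℝ≥0) : ℝ) := by
    refine ⟨1 / (6 * R), by positivity, fun a ha b hb => ?_⟩
    have h3 := abs_le.1 (hR a ha)
    have h4 := abs_le.1 (hR b hb)
    rw [div_mul_eq_mul_div, div_le_iff₀ (by positivity)]
    push_cast
    linarith
  -- Barycentric weights: `w = w₀ + w₁` and `w₀ * z₀ + w₁ * z₁ = w * z'`.
  set w : ((ℝ × ℝ) × (ℝ × ℝ)) × ((ℝ × ℝ) × ℝ) → ℝ := fun τ => ε * (τ.1.2.2 - τ.1.2.1) with hw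
  set w₀ : ((ℝ × ℝ) × (ℝ × ℝ)) × ((ℝ × ℝ) × ℝ) → ℝ := fun τ => ε * (τ.1.2.2 - τ.2.2) with hw₀
  set w₁ : ((ℝ × ℝ) × (ℝ × ℝ)) × ((ℝ × ℝ) × ℝ) → ℝ := fun τ => ε * (τ.2.2 - τ.1.2.1) with hw₁
  have cw : Continuous w := by fun_prop
  have cw₀ : Continuous w₀ := by fun_prop
  have cw₁ : Continuous w₁ := by fun_prop
  have pw₀ : ∀ τ ∈ E, 0 ≤ w₀ τ := fun τ hτ =>
    mul_nonneg hε0.le (by linarith [(hlt τ hτ).2])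
  have pw₁ : ∀ τ ∈ E, 0 ≤ w₁ τ := fun τ hτ =>
    mul_nonneg hε0.le (by linarith [(hlt τ hτ).1])
  have pw : ∀ τ ∈ E, 0 ≤ w τ := fun τ hτ =>
    mul_nonneg hε0.le (by linarith [(hlt τ hτ).1, (hlt τ hτ).2])
  have bw : ∀ᵐ τ ∂Θ, w τ ≤ (3⁻¹ : ℝ≥0) := by
    filter_upwards [hΘ] with τ hτ using hε _ hτ.1.2.2 _ hτ.1.2.1
  have bw₀ : ∀ᵐ τ ∂Θ, w₀ τ ≤ (3⁻¹ : ℝ≥0) := by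
    filter_upwards [hΘ] with τ hτ using hε _ hτ.1.2.2 _ hτ.2.2
  have bw₁ : ∀ᵐ τ ∂Θ, w₁ τ ≤ (3⁻¹ : ℝ≥0) := by
    filter_upwards [hΘ] with τ hτ using hε _ hτ.2.2 _ hτ.1.2.1
  set W := (Θ.restrict E).withDensity fun τ => ENNReal.ofReal (w τ) with hW
  set W₀ := (Θ.restrict E).withDensity fun τ => ENNReal.ofReal (w₀ τ) with hW₀
  set W₁ := (Θ.restrict E).withDensity fun τ => ENNReal.ofReal (w₁ τ) with hW₁
  have hsum : W = W₀ + W₁ := by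
    rw [hW, hW₀, hW₁, ← withDensity_add_left (by fun_prop)]
    refine withDensity_congr_ae ?_
    filter_upwards [ae_restrict_mem hE] with τ hτ
    rw [Pi.add_apply, ← ENNReal.ofReal_add (pw₀ τ hτ) (pw₁ τ hτ)]
    congr 1
    simp only [hw, hw₀, hw₁]
    ring
  have fin : ∀ u : ((ℝ × ℝ) × (ℝ × ℝ)) × ((ℝ × ℝ) × ℝ) → ℝ, (∀ᵐ τ ∂Θ, u τ ≤ (3⁻¹ : ℝ≥0)) →
      IsFiniteMeasure ((Θ.restrict E).withDensity fun τ => ENNReal.ofReal (u τ)) := by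
    intro u hu
    have := map_restrict_withDensity_ofReal_le (E := E) hu measurable_id
    rw [Measure.map_id, Measure.map_id] at this
    exact isFiniteMeasure_of_le _ this
  have fW : IsFiniteMeasure W := fin w bw
  have fW₀ : IsFiniteMeasure W₀ := fin w₀ bw₀
  have fW₁ : IsFiniteMeasure W₁ := fin w₁ bw₁
  -- `N` is the mass removed: `z₀` and `z₁` from `(x, y)`, `z'` from `(x', y')`. `Q` puts it back
  -- with the two starting points interchanged.
  set N := W₀.map (fun τ => (τ.1.1.1, τ.1.1.2, τ.1.2.1)) +
    W₁.map (fun τ => (τ.1.1.1, τ.1.1.2, τ.1.2.2)) +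
    W.map (fun τ => (τ.2.1.1, τ.2.1.2, τ.2.2)) with hN
  set Q := W.map (fun τ => (τ.1.1.1, τ.1.1.2, τ.2.2)) +
    W₀.map (fun τ => (τ.2.1.1, τ.2.1.2, τ.1.2.1)) +
    W₁.map (fun τ => (τ.2.1.1, τ.2.1.2, τ.1.2.2)) with hQ
  have hle : N ≤ (π : Measure (ℝ × ℝ × ℝ)) := by
    have l0 := map_restrict_withDensity_ofReal_le (E := E) bw₀
      (f := fun τ => (τ.1.1.1, τ.1.1.2, τ.1.2.1)) (by fun_prop)
    have l1 := map_restrict_withDensity_ofReal_le (E := E) bw₁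
      (f := fun τ => (τ.1.1.1, τ.1.1.2, τ.1.2.2)) (by fun_prop)
    have l2 := map_restrict_withDensity_ofReal_le (E := E) bw
      (f := fun τ => (τ.2.1.1, τ.2.1.2, τ.2.2)) (by fun_prop)
    rw [h0] at l0
    rw [h1] at l1
    rw [h2] at l2
    refine (add_le_add (add_le_add l0 l1) l2).trans_eq ?_
    rw [← add_smul, ← add_smul]
    have : (3⁻¹ + 3⁻¹ + 3⁻¹ : ℝ≥0) = 1 := by
      rw [← NNReal.coe_inj]; push_cast; norm_num
    rw [this, one_smul]
  -- integrals of continuous functions against `N` and `Q`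
  have ci : ∀ G : ((ℝ × ℝ) × (ℝ × ℝ)) × ((ℝ × ℝ) × ℝ) → ℝ, Continuous G →
      Integrable G (Θ.restrict E) := fun G hG =>
    (hG.integrable_of_ae_mem_isCompact hKT hΘ).restrict
  have cW : ∀ m : Measure (((ℝ × ℝ) × (ℝ × ℝ)) × ((ℝ × ℝ) × ℝ)), IsFiniteMeasure m →
      m ≪ Θ.restrict E → ∀ f : ((ℝ × ℝ) × (ℝ × ℝ)) × ((ℝ × ℝ) × ℝ) → ℝ × ℝ × ℝ,
      Continuous f → ∀ F : ℝ × ℝ × ℝ → ℝ, Continuous F → Integrable F (m.map f) := by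
    intro m hm hmΘ f hf F hF
    rw [integrable_map_measure hF.aestronglyMeasurable hf.measurable.aemeasurable]
    exact (hF.comp hf).integrable_of_ae_mem_isCompact hKT
      (hmΘ.ae_le (ae_restrict_of_ae hΘ))
  have aW : W ≪ Θ.restrict E := withDensity_absolutelyContinuous _ _
  have aW₀ : W₀ ≪ Θ.restrict E := withDensity_absolutelyContinuous _ _
  have aW₁ : W₁ ≪ Θ.restrict E := withDensity_absolutelyContinuous _ _
  have intN : ∀ F : ℝ × ℝ × ℝ → ℝ, Continuous F → ∫ p, F p ∂N = ∫ τ in E,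
      (w₀ τ * F (τ.1.1.1, τ.1.1.2, τ.1.2.1) + w₁ τ * F (τ.1.1.1, τ.1.1.2, τ.1.2.2)
        + w τ * F (τ.2.1.1, τ.2.1.2, τ.2.2)) ∂Θ := by
    intro F hF
    rw [integral_add (ci _ (by fun_prop)) (ci _ (by fun_prop)),
      integral_add (ci _ (by fun_prop)) (ci _ (by fun_prop)), hN,
      integral_add_measure ((cW _ fW₀ aW₀ _ (by fun_prop) F hF).add_measure
        (cW _ fW₁ aW₁ _ (by fun_prop) F hF)) (cW _ fW aW _ (by fun_prop) F hF),
      integral_add_measure (cW _ fW₀ aW₀ _ (by fun_prop) F hF)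
        (cW _ fW₁ aW₁ _ (by fun_prop) F hF)]
    rw [integral_map_restrict_withDensity_ofReal hE cw₀.measurable pw₀ (by fun_prop) hF.measurable,
      integral_map_restrict_withDensity_ofReal hE cw₁.measurable pw₁ (by fun_prop) hF.measurable,
      integral_map_restrict_withDensity_ofReal hE cw.measurable pw (by fun_prop) hF.measurable]
  have intQ : ∀ F : ℝ × ℝ × ℝ → ℝ, Continuous F → ∫ p, F p ∂Q = ∫ τ in E,
      (w τ * F (τ.1.1.1, τ.1.1.2, τ.2.2) + w₀ τ * F (τ.2.1.1, τ.2.1.2, τ.1.2.1)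
        + w₁ τ * F (τ.2.1.1, τ.2.1.2, τ.1.2.2)) ∂Θ := by
    intro F hF
    rw [integral_add (ci _ (by fun_prop)) (ci _ (by fun_prop)),
      integral_add (ci _ (by fun_prop)) (ci _ (by fun_prop)), hQ,
      integral_add_measure ((cW _ fW aW _ (by fun_prop) F hF).add_measure
        (cW _ fW₀ aW₀ _ (by fun_prop) F hF)) (cW _ fW₁ aW₁ _ (by fun_prop) F hF),
      integral_add_measure (cW _ fW aW _ (by fun_prop) F hF)
        (cW _ fW₀ aW₀ _ (by fun_prop) F hF)]
    rw [integral_map_restrict_withDensity_ofReal hE cw₀.measurable pw₀ (by fun_prop) hF.measurable,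
      integral_map_restrict_withDensity_ofReal hE cw₁.measurable pw₁ (by fun_prop) hF.measurable,
      integral_map_restrict_withDensity_ofReal hE cw.measurable pw (by fun_prop) hF.measurable]
  have fm : ∀ (m : Measure (((ℝ × ℝ) × (ℝ × ℝ)) × ((ℝ × ℝ) × ℝ))) (f), IsFiniteMeasure m →
      IsFiniteMeasure (m.map f : Measure (ℝ × ℝ × ℝ)) := fun m f _ => inferInstance
  have fN : IsFiniteMeasure N := inferInstance
  have fQ : IsFiniteMeasure Q := inferInstance
  have hxy : N.map (fun p => (p.1, p.2.1)) = Q.map (fun p => (p.1, p.2.1)) := by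
    have hm : Measurable (fun p : ℝ × ℝ × ℝ => (p.1, p.2.1)) := by fun_prop
    rw [hN, hQ]
    simp only [Measure.map_add _ _ hm]
    repeat rw [Measure.map_map hm (by fun_prop)]
    simp only [Function.comp_def, hsum]
    rw [Measure.map_add _ _ (by fun_prop), Measure.map_add _ _ (by fun_prop)]
    abel
  have hz : N.map (fun p => p.2.2) = Q.map (fun p => p.2.2) := by
    have hm : Measurable (fun p : ℝ × ℝ × ℝ => p.2.2) := by fun_prop
    rw [hN, hQ]
    simp only [Measure.map_add _ _ hm]
    repeat rw [Measure.map_map hm (by fun_prop)]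
    simp only [Function.comp_def]
    abel
  have hmart : ∀ g : ℝ × ℝ → ℝ, Continuous g → ∫ p, g (p.1, p.2.1) * (p.2.2 - p.2.1) ∂N =
      ∫ p, g (p.1, p.2.1) * (p.2.2 - p.2.1) ∂Q := by
    intro g hg
    rw [intN _ (by fun_prop), intQ _ (by fun_prop)]
    congr 1
    funext τ
    simp only [hw, hw₀, hw₁]
    ring
  obtain ⟨π', hπ', hM', hint⟩ := exists_coupling_of_exchange hX hY hZ hμX hμY hμZ hπ hM hle hxy hz
    hmart
  have hge : 0 ≤ ∫ p, C p ∂Q - ∫ p, C p ∂N := by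
    have := hopt π' hπ' hM'
    have := hint C hC
    linarith
  rw [intN C hC, intQ C hC, ← integral_sub (ci _ (by fun_prop)) (ci _ (by fun_prop))] at hge
  refine (mul_nonneg_iff_of_pos_left hε0).1 (hge.trans_eq ?_)
  rw [← integral_const_mul]
  congr 1
  funext τ
  simp only [hw, hw₀, hw₁]
  ring

/-- The left side is `φ x - φ x'` for the `φ` below. Strict concavity of `∂ₓ c` in `z`, applied to
`z'` as a convex combination of `z₀` and `z₁`, makes the derivative of `φ` positive. -/
theorem MartingaleSpenceMirrlees.exchange_lt {xlo xhi : ℝ} {Z : Set ℝ} {c : ℝ → ℝ → ℝ}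
    (h : MartingaleSpenceMirrlees (Icc xlo xhi) Z c) {x x' : ℝ} (hx : x ∈ Icc xlo xhi)
    (hx' : x' ∈ Icc xlo xhi) (hxx : x < x') {z₀ z' z₁ : ℝ} (hz₀ : z₀ ∈ Z) (hz' : z' ∈ Z)
    (hz₁ : z₁ ∈ Z) (h0 : z₀ < z') (h1 : z' < z₁) :
    (z₁ - z₀) * (c x z' - c x' z') + (z₁ - z') * (c x' z₀ - c x z₀)
      + (z' - z₀) * (c x' z₁ - c x z₁) < 0 := by
  obtain ⟨hd, hs⟩ := h
  set φ : ℝ → ℝ := fun s => (z₁ - z₀) * c s z' - (z₁ - z') * c s z₀ - (z' - z₀) * c s z₁ with hφ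
  have hsub : Icc x x' ⊆ Icc xlo xhi := Icc_subset_Icc hx.1 hx'.2
  have hφd : DifferentiableOn ℝ φ (Icc xlo xhi) :=
    (((hd z' hz').const_mul _).sub ((hd z₀ hz₀).const_mul _)).sub ((hd z₁ hz₁).const_mul _)
  have hmono : StrictMonoOn φ (Icc x x') := by
    refine strictMonoOn_of_deriv_pos (convex_Icc _ _) (hφd.continuousOn.mono hsub) ?_
    intro s hs'
    rw [interior_Icc] at hs'
    have hsX : s ∈ Icc xlo xhi := hsub (Ioo_subset_Icc_self hs')
    have hn : Icc xlo xhi ∈ nhds s :=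
      Filter.mem_of_superset (Ioo_mem_nhds hs'.1 hs'.2) (Ioo_subset_Icc_self.trans hsub)
    have D : ∀ z ∈ Z, HasDerivAt (fun t => c t z)
        (derivWithin (fun t => c t z) (Icc xlo xhi) s) s := fun z hz =>
      ((hd z hz s hsX).hasDerivWithinAt).hasDerivAt hn
    have hD := (((D z' hz').const_mul (z₁ - z₀)).sub ((D z₀ hz₀).const_mul (z₁ - z'))).sub
      ((D z₁ hz₁).const_mul (z' - z₀))
    have hD' : deriv φ s = _ := hD.deriv
    rw [hD']
    have hpos : 0 < z₁ - z₀ := by linarith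
    have e : (1 - (z' - z₀) / (z₁ - z₀)) * z₀ + (z' - z₀) / (z₁ - z₀) * z₁ = z' := by
      field_simp
      ring
    have key := hs s hsX z₀ hz₀ z₁ hz₁ (by linarith) ((z' - z₀) / (z₁ - z₀))
      (div_pos (by linarith) hpos) ((div_lt_one hpos).2 (by linarith)) (by rw [e]; exact hz')
    simp only [e] at key
    have e2 : 1 - (z' - z₀) / (z₁ - z₀) = (z₁ - z') / (z₁ - z₀) := by
      field_simp
      ring
    rw [e2, div_mul_eq_mul_div, div_mul_eq_mul_div, ← add_div, div_lt_iff₀ hpos] at key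
    linarith
  have := hmono (left_mem_Icc.2 hxx.le) (right_mem_Icc.2 hxx.le) hxx
  simp only [hφ] at this
  linarith

theorem measure_eq_zero_of_setIntegral_nonneg {α : Type*} [MeasurableSpace α] {μ : Measure α}
    {E : Set α} (hE : MeasurableSet E) {f : α → ℝ} (hf : IntegrableOn f E μ)
    (h : 0 ≤ ∫ a in E, f a ∂μ) (hneg : ∀ᵐ a ∂μ, a ∈ E → f a < 0) : μ E = 0 := by
  have h1 : ∀ᵐ a ∂μ.restrict E, f a < 0 := (ae_restrict_iff' hE).2 hneg
  have h2 : ∫ a in E, -f a ∂μ = 0 := by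
    refine le_antisymm ?_ ?_
    · rw [integral_neg]
      linarith
    · refine integral_nonneg_of_ae ?_
      filter_upwards [h1] with a ha
      simp only [Pi.zero_apply]
      linarith
  rw [integral_eq_zero_iff_of_nonneg_ae] at h2
  · have h3 : ∀ᵐ a ∂μ.restrict E, False := by
      filter_upwards [h1, h2] with a ha hb
      simp only [Pi.zero_apply] at hb
      linarith
    simpa using h3
  · filter_upwards [h1] with a ha
    simp only [Pi.zero_apply]
    linarith
  · exact hf.neg

/-! ### Two-point conditional laws. -/

/-- If a.e. pair of independent copies of `(p, z₀, z₁)` and `(p', z')` is not in the forbidden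
configuration, then the kernel cannot charge three consecutive sets at a nonnegligible set of
points at the same level `y`. -/
theorem measure_charging_three_eq_zero {ρ : Measure (ℝ × ℝ)} [IsProbabilityMeasure ρ]
    (hρ : ∀ x : ℝ, ∀ᵐ p ∂ρ, p.1 ≠ x) (η : Kernel (ℝ × ℝ) ℝ) [IsMarkovKernel η]
    (h : ∀ᵐ τ ∂((ρ ⊗ₘ (η ×ₖ η)).prod (ρ ⊗ₘ η)),
      ¬ (τ.1.1.2 = τ.2.1.2 ∧ τ.1.1.1 < τ.2.1.1 ∧ τ.1.2.1 < τ.2.2 ∧ τ.2.2 < τ.1.2.2))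
    (y q r : ℝ) :
    ∀ᵐ p ∂ρ, p.2 = y → η p (Iio q) = 0 ∨ η p (Ioo q r) = 0 ∨ η p (Ioi r) = 0 := by
  set A : Set (ℝ × ℝ) :=
    {p | p.2 = y ∧ η p (Iio q) ≠ 0 ∧ η p (Ioo q r) ≠ 0 ∧ η p (Ioi r) ≠ 0} with hA
  have hAm : MeasurableSet A := by
    have m : ∀ S : Set ℝ, MeasurableSet S → MeasurableSet {p : ℝ × ℝ | η p S ≠ 0} := fun S hS =>
      (η.measurable_coe hS (measurableSet_singleton 0)).compl
    exact (measurable_snd (measurableSet_singleton y)).inter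
      ((m _ measurableSet_Iio).inter ((m _ measurableSet_Ioo).inter (m _ measurableSet_Ioi)))
  -- If `p` and `p'` lie in `A`, one can draw `z₀ < q` and `z₁ > r` from `p` and `z'` in `(q, r)`
  -- from `p'`; a forbidden configuration results unless `p'.1 ≤ p.1`.
  have h1 : ∀ᵐ p ∂ρ.restrict A, ∀ᵐ p' ∂ρ.restrict A, p'.1 ≤ p.1 := by
    rw [ae_restrict_iff' hAm]
    filter_upwards [Measure.ae_ae_of_ae_compProd (Measure.ae_ae_of_ae_prod h)] with p hp hpA
    rw [Kernel.prod_apply] at hp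
    have hfreq : ∃ᶠ zz in ae ((η p).prod (η p)), zz ∈ Iio q ×ˢ Ioi r := by
      rw [frequently_ae_mem_iff, Measure.prod_prod]
      exact mul_ne_zero hpA.2.1 hpA.2.2.2
    obtain ⟨zz, hzz, hb⟩ := (hfreq.and_eventually hp).exists
    rw [ae_restrict_iff' hAm]
    filter_upwards [Measure.ae_ae_of_ae_compProd hb] with p' hp' hpA'
    have hfreq' : ∃ᶠ z in ae (η p'), z ∈ Ioo q r := by
      rw [frequently_ae_mem_iff]
      exact hpA'.2.2.1
    obtain ⟨z, hz, hz'⟩ := (hfreq'.and_eventually hp').exists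
    by_contra hlt
    exact hz' ⟨hpA.1.trans hpA'.1.symm, not_le.1 hlt, (mem_Iio.1 hzz.1).trans hz.1,
      hz.2.trans (mem_Ioi.1 hzz.2)⟩
  -- By symmetry almost all pairs in `A` have equal first coordinate, which a law without atoms
  -- allows only when `A` is null.
  have h2 : ∀ᵐ p ∂ρ.restrict A, ∀ᵐ p' ∂ρ.restrict A, p.1 ≤ p'.1 :=
    (Measure.ae_ae_comm (p := fun p p' : ℝ × ℝ => p'.1 ≤ p.1)
      (measurableSet_le (by fun_prop) (by fun_prop))).1 h1
  have h4 : ρ A = 0 := by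
    by_contra hne
    have : (ae (ρ.restrict A)).NeBot := by
      rw [ae_neBot]
      simpa [Measure.restrict_eq_zero] using hne
    obtain ⟨p, hp1, hp2⟩ := (h1.and h2).exists
    obtain ⟨p', ⟨a, b⟩, c⟩ := ((hp1.and hp2).and (ae_restrict_of_ae (hρ p.1))).exists
    exact c (le_antisymm a b)
  have h5 : ∀ᵐ p ∂ρ, p ∉ A := measure_eq_zero_iff_ae_notMem.1 h4
  filter_upwards [h5] with p hp hy
  by_contra hcon
  push Not at hcon
  exact hp ⟨hy, hcon⟩

/-- Three support points could be separated by rationals `q < r`, and all three sets would be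
charged. Rational thresholds keep the exceptional null sets countable when this is applied to a
kernel. -/
theorem exists_pair_of_not_charging_three (m : Measure ℝ)
    (h : ∀ q r : ℚ, m (Iio (q : ℝ)) = 0 ∨ m (Ioo (q : ℝ) r) = 0 ∨ m (Ioi (r : ℝ)) = 0) :
    ∃ a b : ℝ, ∀ᵐ z ∂m, z = a ∨ z = b := by
  have three : ∀ a ∈ m.support, ∀ b ∈ m.support, ∀ c ∈ m.support, a < b → b < c → False := by
    intro a ha b hb c hc hab hbc
    obtain ⟨q, hq1, hq2⟩ := exists_rat_btwn hab
    obtain ⟨r, hr1, hr2⟩ := exists_rat_btwn hbc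
    rw [Measure.mem_support_iff_forall] at ha hb hc
    rcases h q r with h | h | h
    · exact (ha _ (Iio_mem_nhds hq1)).ne' h
    · exact (hb _ (Ioo_mem_nhds hq2 hr1)).ne' h
    · exact (hc _ (Ioi_mem_nhds hr2)).ne' h
  by_cases hne : ∃ a ∈ m.support, ∃ b ∈ m.support, a < b
  · obtain ⟨a, ha, b, hb, hab⟩ := hne
    refine ⟨a, b, ?_⟩
    filter_upwards [Measure.support_mem_ae (μ := m)] with z hz
    by_contra hcon
    push Not at hcon
    rcases lt_or_gt_of_ne hcon.1 with h1 | h1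
    · exact three z hz a ha b hb h1 hab
    · rcases lt_or_gt_of_ne hcon.2 with h2 | h2
      · exact three a ha z hz b hb h1 h2
      · exact three a ha b hb z hz hab h2
  · push Not at hne
    by_cases h0 : m.support.Nonempty
    · obtain ⟨a, ha⟩ := h0
      refine ⟨a, a, ?_⟩
      filter_upwards [Measure.support_mem_ae (μ := m)] with z hz
      exact Or.inl (le_antisymm (hne a ha z hz) (hne z hz a ha))
    · refine ⟨0, 0, ?_⟩
      filter_upwards [Measure.support_mem_ae (μ := m)] with z hz
      exact absurd ⟨z, hz⟩ h0

/-- Total mass and mean form a linear system for the two weights, with determinant `a - b` up to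
sign; when `a = b` both laws are the Dirac mass. -/
theorem eq_of_ae_pair_of_integral_eq {κ κ' : Measure ℝ} [IsProbabilityMeasure κ]
    [IsProbabilityMeasure κ'] {a b : ℝ} (h : ∀ᵐ z ∂κ, z = a ∨ z = b)
    (h' : ∀ᵐ z ∂κ', z = a ∨ z = b) (hint : ∫ z, z ∂κ = ∫ z, z ∂κ') : κ = κ' := by
  have rep : ∀ m : Measure ℝ, IsProbabilityMeasure m → (∀ᵐ z ∂m, z = a ∨ z = b) → a ≠ b →
      m = m {a} • Measure.dirac a + m {b} • Measure.dirac b := by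
    intro m _ hm hab
    have h1 : m.restrict ({a} ∪ {b}) = m :=
      Measure.restrict_eq_self_of_ae_mem (by filter_upwards [hm] with z hz using hz)
    rw [Measure.restrict_union (by simpa using hab) (measurableSet_singleton b),
      Measure.restrict_singleton, Measure.restrict_singleton] at h1
    exact h1.symm
  have sums : ∀ m : Measure ℝ, IsProbabilityMeasure m →
      m = m {a} • Measure.dirac a + m {b} • Measure.dirac b →
      m.real {a} + m.real {b} = 1 ∧ ∫ z, z ∂m = m.real {a} * a + m.real {b} * b := by
    intro m _ hm
    constructor
    · have h1 := congrArg (fun n => n univ) hm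
      simp only [measure_univ, Measure.add_apply, Measure.smul_apply, smul_eq_mul, mul_one] at h1
      have := congrArg ENNReal.toReal h1
      rw [ENNReal.toReal_add (measure_ne_top _ _) (measure_ne_top _ _)] at this
      simpa [Measure.real] using this.symm
    · conv_lhs => rw [hm]
      have hi : ∀ c : ℝ, Integrable (fun z : ℝ => z) (m {c} • Measure.dirac c) := fun c =>
        (integrable_dirac (by simp)).smul_measure (measure_ne_top _ _)
      rw [integral_add_measure (hi a) (hi b), integral_smul_measure, integral_smul_measure]
      simp [Measure.real]
  rcases eq_or_ne a b with rfl | hab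
  · have one : ∀ m : Measure ℝ, IsProbabilityMeasure m → (∀ᵐ z ∂m, z = a ∨ z = a) →
        m = Measure.dirac a := by
      intro m _ hm
      have h1 : m.restrict {a} = m :=
        Measure.restrict_eq_self_of_ae_mem (by filter_upwards [hm] with z hz; simpa using hz)
      rw [Measure.restrict_singleton] at h1
      have h2 : m {a} = 1 := by
        have := congrArg (fun n => n univ) h1
        simpa using this
      rw [h2, one_smul] at h1
      exact h1.symm
    rw [one κ inferInstance h, one κ' inferInstance h']
  · have r := rep κ inferInstance h hab
    have r' := rep κ' inferInstance h' hab
    obtain ⟨s1, s2⟩ := sums κ inferInstance r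
    obtain ⟨s1', s2'⟩ := sums κ' inferInstance r'
    rw [s2, s2'] at hint
    have hA : κ.real {a} = κ'.real {a} := by
      have : (κ.real {a} - κ'.real {a}) * (a - b) = 0 := by
        have e1 : κ.real {b} = 1 - κ.real {a} := by linarith
        have e2 : κ'.real {b} = 1 - κ'.real {a} := by linarith
        rw [e1, e2] at hint
        linarith
      rcases mul_eq_zero.1 this with h0 | h0
      · linarith
      · exact absurd (sub_eq_zero.1 h0) hab
    have hB : κ.real {b} = κ'.real {b} := by linarith
    rw [r, r', (measureReal_eq_measureReal_iff).1 hA, (measureReal_eq_measureReal_iff).1 hB]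

theorem map_regroup (π : ProbabilityMeasure (ℝ × ℝ × ℝ)) :
    (regroup π).map (fun s => (s.1.1, s.1.2, s.2)) = (π : Measure (ℝ × ℝ × ℝ)) := by
  rw [regroup, Measure.map_map (by fun_prop) (by fun_prop)]
  exact Measure.map_id

theorem regroup_injective : Function.Injective regroup := by
  intro π π' h
  refine Subtype.ext ?_
  have h1 := map_regroup π
  rw [h, map_regroup π'] at h1
  exact h1.symm

instance (π : ProbabilityMeasure (ℝ × ℝ × ℝ)) : IsProbabilityMeasure (regroup π) :=
  Measure.isProbabilityMeasure_map (by fun_prop)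

/-- The law draws `(x, y)` with two conditionally independent `z₀`, `z₁`, and independently a copy
`((x', y'), z')`. Each of the three triples has law `π`, as `setIntegral_exchange_nonneg` demands.
-/
theorem map_triple_eq (π : ProbabilityMeasure (ℝ × ℝ × ℝ)) {ρ : Measure (ℝ × ℝ)}
    [IsProbabilityMeasure ρ] {η : Kernel (ℝ × ℝ) ℝ} [IsMarkovKernel η]
    (h : regroup π = ρ ⊗ₘ η) :
    ((ρ ⊗ₘ (η ×ₖ η)).prod (ρ ⊗ₘ η)).map (fun τ => (τ.1.1.1, τ.1.1.2, τ.1.2.1)) = π ∧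
    ((ρ ⊗ₘ (η ×ₖ η)).prod (ρ ⊗ₘ η)).map (fun τ => (τ.1.1.1, τ.1.1.2, τ.1.2.2)) = π ∧
    ((ρ ⊗ₘ (η ×ₖ η)).prod (ρ ⊗ₘ η)).map (fun τ => (τ.2.1.1, τ.2.1.2, τ.2.2)) = π := by
  have hm : Measurable (fun s : (ℝ × ℝ) × ℝ => (s.1.1, s.1.2, s.2)) := by fun_prop
  have e0 : (ρ ⊗ₘ (η ×ₖ η)).map (Prod.map id Prod.fst) = ρ ⊗ₘ η := by
    rw [← Measure.compProd_map measurable_fst, ← Kernel.fst_eq, Kernel.fst_prod]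
  have e1 : (ρ ⊗ₘ (η ×ₖ η)).map (Prod.map id Prod.snd) = ρ ⊗ₘ η := by
    rw [← Measure.compProd_map measurable_snd, ← Kernel.snd_eq, Kernel.snd_prod]
  have ef : ((ρ ⊗ₘ (η ×ₖ η)).prod (ρ ⊗ₘ η)).map Prod.fst = ρ ⊗ₘ (η ×ₖ η) := by
    rw [Measure.map_fst_prod, measure_univ, one_smul]
  have es : ((ρ ⊗ₘ (η ×ₖ η)).prod (ρ ⊗ₘ η)).map Prod.snd = ρ ⊗ₘ η := by
    rw [Measure.map_snd_prod, measure_univ, one_smul]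
  have key : ∀ f : ((ℝ × ℝ) × (ℝ × ℝ)) × ((ℝ × ℝ) × ℝ) → (ℝ × ℝ) × ℝ, Measurable f →
      ((ρ ⊗ₘ (η ×ₖ η)).prod (ρ ⊗ₘ η)).map f = ρ ⊗ₘ η →
      ((ρ ⊗ₘ (η ×ₖ η)).prod (ρ ⊗ₘ η)).map (fun τ => ((f τ).1.1, (f τ).1.2, (f τ).2)) = π := by
    intro f hf hfm
    rw [← map_regroup π, h]
    conv_rhs => rw [← hfm]
    exact (Measure.map_map hm hf).symm
  refine ⟨key (Prod.map id Prod.fst ∘ Prod.fst) (by fun_prop) ?_,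
    key (Prod.map id Prod.snd ∘ Prod.fst) (by fun_prop) ?_, key Prod.snd measurable_snd es⟩
  · rw [← Measure.map_map (by fun_prop) measurable_fst, ef, e0]
  · rw [← Measure.map_map (by fun_prop) measurable_fst, ef, e1]

/-- Under the martingale Spence–Mirrlees condition, the conditional laws of `z` given `(x, y)` under
an optimal coupling are a.e. carried by at most two points when `y` takes only two values. -/
theorem ae_exists_pair_of_optimal {μX μY μZ : Measure ℝ} {xlo xhi : ℝ} {Y Z : Set ℝ}
    (hY : IsCompact Y) (hZ : IsCompact Z) (hμX : μX (Icc xlo xhi)ᶜ = 0) (hμY : μY Yᶜ = 0)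
    (hμZ : μZ Zᶜ = 0) (hatoms : ∀ x : ℝ, μX {x} = 0) {y₁ y₂ : ℝ}
    (hyy : μY {y₁, y₂}ᶜ = 0)
    {π : ProbabilityMeasure (ℝ × ℝ × ℝ)} (hπ : π ∈ Couplings μX μY μZ)
    (hM : MartingaleTests (π : Measure (ℝ × ℝ × ℝ)))
    {C₁ C₂ C₃ : ℝ × ℝ → ℝ} (hC₁ : Continuous C₁) (hC₂ : Continuous C₂) (hC₃ : Continuous C₃)
    {c₃ : ℝ → ℝ → ℝ} (hc₃ : ∀ x ∈ Icc xlo xhi, ∀ z ∈ Z, C₃ (x, z) = c₃ x z)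
    (hSM : MartingaleSpenceMirrlees (Icc xlo xhi) Z c₃)
    (hopt : ∀ π' ∈ Couplings μX μY μZ, MartingaleTests (π' : Measure (ℝ × ℝ × ℝ)) →
      ∫ p, (C₁ (p.1, p.2.1) + C₂ (p.2.1, p.2.2) + C₃ (p.1, p.2.2)) ∂(π : Measure (ℝ × ℝ × ℝ)) ≤
      ∫ p, (C₁ (p.1, p.2.1) + C₂ (p.2.1, p.2.2) + C₃ (p.1, p.2.2)) ∂(π' : Measure (ℝ × ℝ × ℝ)))
    {ρ : Measure (ℝ × ℝ)} [IsProbabilityMeasure ρ] {η : Kernel (ℝ × ℝ) ℝ} [IsMarkovKernel η]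
    (hρη : regroup π = ρ ⊗ₘ η) :
    ∀ᵐ p ∂ρ, ∃ a b : ℝ, ∀ᵐ z ∂η p, z = a ∨ z = b := by
  obtain ⟨m0, m1, m2⟩ := map_triple_eq π hρη
  set Θ := (ρ ⊗ₘ (η ×ₖ η)).prod (ρ ⊗ₘ η) with hΘ
  set E : Set (((ℝ × ℝ) × (ℝ × ℝ)) × ((ℝ × ℝ) × ℝ)) :=
    {τ | τ.1.1.2 = τ.2.1.2 ∧ τ.1.1.1 < τ.2.1.1 ∧ τ.1.2.1 < τ.2.2 ∧ τ.2.2 < τ.1.2.2} with hE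
  have hEm : MeasurableSet E := by
    have l : ∀ f g : ((ℝ × ℝ) × (ℝ × ℝ)) × ((ℝ × ℝ) × ℝ) → ℝ, Measurable f → Measurable g →
        MeasurableSet {τ | f τ < g τ} := fun f g hf hg => measurableSet_lt hf hg
    have e : MeasurableSet {τ : ((ℝ × ℝ) × (ℝ × ℝ)) × ((ℝ × ℝ) × ℝ) | τ.1.1.2 = τ.2.1.2} :=
      measurableSet_eq_fun (by fun_prop) (by fun_prop)
    exact e.inter ((l (fun τ => τ.1.1.1) (fun τ => τ.2.1.1) (by fun_prop) (by fun_prop)).inter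
      ((l (fun τ => τ.1.2.1) (fun τ => τ.2.2) (by fun_prop) (by fun_prop)).inter
        (l (fun τ => τ.2.2) (fun τ => τ.1.2.2) (by fun_prop) (by fun_prop))))
  have hge := setIntegral_exchange_nonneg isCompact_Icc hY hZ hμX hμY hμZ hπ hM
    (C := fun p => C₁ (p.1, p.2.1) + C₂ (p.2.1, p.2.2) + C₃ (p.1, p.2.2)) (by fun_prop) hopt Θ
    m0 m1 m2 hEm (fun τ hτ => ⟨hτ.2.2.1, hτ.2.2.2⟩)
  have haeπ := Couplings.ae_mem hπ measurableSet_Icc hY.measurableSet hZ.measurableSet hμX hμY hμZ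
  have k0 := ae_of_ae_map (f := fun τ : ((ℝ × ℝ) × (ℝ × ℝ)) × ((ℝ × ℝ) × ℝ) =>
    (τ.1.1.1, τ.1.1.2, τ.1.2.1)) (μ := Θ) (by fun_prop) (by rw [m0]; exact haeπ)
  have k1 := ae_of_ae_map (f := fun τ : ((ℝ × ℝ) × (ℝ × ℝ)) × ((ℝ × ℝ) × ℝ) =>
    (τ.1.1.1, τ.1.1.2, τ.1.2.2)) (μ := Θ) (by fun_prop) (by rw [m1]; exact haeπ)
  have k2 := ae_of_ae_map (f := fun τ : ((ℝ × ℝ) × (ℝ × ℝ)) × ((ℝ × ℝ) × ℝ) =>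
    (τ.2.1.1, τ.2.1.2, τ.2.2)) (μ := Θ) (by fun_prop) (by rw [m2]; exact haeπ)
  have hKT : IsCompact (((Icc xlo xhi ×ˢ Y) ×ˢ (Z ×ˢ Z)) ×ˢ ((Icc xlo xhi ×ˢ Y) ×ˢ Z)) :=
    ((isCompact_Icc.prod hY).prod (hZ.prod hZ)).prod ((isCompact_Icc.prod hY).prod hZ)
  have hΘK : ∀ᵐ τ ∂Θ,
      τ ∈ ((Icc xlo xhi ×ˢ Y) ×ˢ (Z ×ˢ Z)) ×ˢ ((Icc xlo xhi ×ˢ Y) ×ˢ Z) := by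
    filter_upwards [k0, k1, k2] with τ q0 q1 q2
    exact ⟨⟨⟨q0.1, q0.2.1⟩, ⟨q0.2.2, q1.2.2⟩⟩, ⟨⟨q2.1, q2.2.1⟩, q2.2.2⟩⟩
  have hΘE : Θ E = 0 := by
    refine measure_eq_zero_of_setIntegral_nonneg hEm
      (Integrable.integrableOn (Continuous.integrable_of_ae_mem_isCompact hKT hΘK
        (by fun_prop))) hge ?_
    filter_upwards [hΘK] with τ hτ hτE
    obtain ⟨⟨⟨hx, -⟩, hz0, hz1⟩, ⟨hx', -⟩, hz'⟩ := hτ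
    obtain ⟨hy, hlt, h1, h2⟩ := hτE
    have := hSM.exchange_lt hx hx' hlt hz0 hz' hz1 h1 h2
    -- The `C₁` terms cancel because `(z₁ - z₀) - (z₁ - z') - (z' - z₀) = 0`, the `C₂` terms because
    -- `y = y'`; only the `c₃` exchange remains.
    simp only [hc₃ _ hx _ hz0, hc₃ _ hx _ hz', hc₃ _ hx _ hz1, hc₃ _ hx' _ hz0, hc₃ _ hx' _ hz',
      hc₃ _ hx' _ hz1, hy]
    linarith
  have hnot : ∀ᵐ τ ∂Θ, ¬ (τ.1.1.2 = τ.2.1.2 ∧ τ.1.1.1 < τ.2.1.1 ∧ τ.1.2.1 < τ.2.2 ∧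
      τ.2.2 < τ.1.2.2) := measure_eq_zero_iff_ae_notMem.1 hΘE
  have hρ : ρ = (π : Measure (ℝ × ℝ × ℝ)).map (fun p => (p.1, p.2.1)) := by
    have h1 : (regroup π).fst = ρ := by rw [hρη, Measure.fst_compProd]
    rw [← h1, regroup, Measure.fst, Measure.map_map measurable_fst (by fun_prop)]
    rfl
  have hρx : ∀ x : ℝ, ∀ᵐ p ∂ρ, p.1 ≠ x := by
    intro x
    have h1 : ρ.map Prod.fst = μX := by
      rw [hρ, Measure.map_map measurable_fst (by fun_prop)]
      exact hπ.1
    refine ae_of_ae_map (p := fun t => t ≠ x) measurable_fst.aemeasurable ?_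
    rw [h1]
    exact measure_eq_zero_iff_ae_notMem.1 (hatoms x)
  have hρy : ∀ᵐ p ∂ρ, p.2 = y₁ ∨ p.2 = y₂ := by
    have h1 : ρ.map Prod.snd = μY := by
      rw [hρ, Measure.map_map measurable_snd (by fun_prop)]
      exact hπ.2.1
    refine ae_of_ae_map (p := fun t => t = y₁ ∨ t = y₂) measurable_snd.aemeasurable ?_
    rw [h1]
    exact hyy
  have key : ∀ q r : ℚ, ∀ᵐ p ∂ρ,
      η p (Iio (q : ℝ)) = 0 ∨ η p (Ioo (q : ℝ) r) = 0 ∨ η p (Ioi (r : ℝ)) = 0 := by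
    intro q r
    filter_upwards [hρy, measure_charging_three_eq_zero hρx η hnot y₁ q r,
      measure_charging_three_eq_zero hρx η hnot y₂ q r] with p h1 h2 h3
    rcases h1 with h1 | h1
    · exact h2 h1
    · exact h3 h1
  filter_upwards [ae_all_iff.2 fun q => ae_all_iff.2 (key q)] with p hp
  exact exists_pair_of_not_charging_three _ hp

/-! ### The law of `(x, y)`, averaging, and uniqueness. -/

/-- On `{y₁, y₂}` every function of `y` is affine. Expanding `h (x, ·)` around `y = x` leaves a term
linear in `y - x`, which the martingale constraint kills. -/
theorem integral_fst_snd_of_martingaleTests {μX μY μZ : Measure ℝ} {X Y Z : Set ℝ}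
    (hX : IsCompact X) (hY : IsCompact Y) (hZ : IsCompact Z) (hμX : μX Xᶜ = 0) (hμY : μY Yᶜ = 0)
    (hμZ : μZ Zᶜ = 0) {y₁ y₂ : ℝ} (hyy : μY {y₁, y₂}ᶜ = 0)
    {π : ProbabilityMeasure (ℝ × ℝ × ℝ)} (hπ : π ∈ Couplings μX μY μZ)
    (hM : MartingaleTests (π : Measure (ℝ × ℝ × ℝ))) {h : ℝ × ℝ → ℝ} (hh : Continuous h) :
    (y₂ - y₁) * ∫ p, h (p.1, p.2.1) ∂(π : Measure (ℝ × ℝ × ℝ)) =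
      ∫ x, (h (x, y₁) * (y₂ - x) + h (x, y₂) * (x - y₁)) ∂μX := by
  have hK : IsCompact (X ×ˢ Y ×ˢ Z) := hX.prod (hY.prod hZ)
  have hae := Couplings.ae_mem hπ hX.measurableSet hY.measurableSet hZ.measurableSet hμX hμY hμZ
  have hyπ : ∀ᵐ p ∂(π : Measure (ℝ × ℝ × ℝ)), p.2.1 = y₁ ∨ p.2.1 = y₂ := by
    refine ae_of_ae_map (f := fun p : ℝ × ℝ × ℝ => p.2.1) (p := fun t => t = y₁ ∨ t = y₂)
      (by fun_prop) ?_
    rw [hπ.2.1]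
    exact hyy
  have ci : ∀ F : ℝ × ℝ × ℝ → ℝ, Continuous F → Integrable F (π : Measure (ℝ × ℝ × ℝ)) :=
    fun F hF => hF.integrable_of_ae_mem_isCompact hK hae
  have e1 := hM.1 (fun x => h (x, y₂) - h (x, y₁)) (by fun_prop)
  have e2 : ∫ p, (y₂ - y₁) * h (p.1, p.2.1) ∂(π : Measure (ℝ × ℝ × ℝ)) =
      ∫ p, ((h (p.1, y₁) * (y₂ - p.1) + h (p.1, y₂) * (p.1 - y₁)) +
        (h (p.1, y₂) - h (p.1, y₁)) * (p.2.1 - p.1)) ∂(π : Measure (ℝ × ℝ × ℝ)) := by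
    refine integral_congr_ae ?_
    filter_upwards [hyπ] with p hp
    rcases hp with hp | hp
    · rw [hp]
      ring
    · rw [hp]
      ring
  rw [← integral_const_mul, e2, integral_add (ci _ (by fun_prop)) (ci _ (by fun_prop)), e1,
    add_zero, ← hπ.1, integral_map (by fun_prop)]
  exact (by fun_prop : Continuous fun x : ℝ =>
    h (x, y₁) * (y₂ - x) + h (x, y₂) * (x - y₁)).aestronglyMeasurable

theorem regroup_fst (π : ProbabilityMeasure (ℝ × ℝ × ℝ)) :
    (regroup π).fst = (π : Measure (ℝ × ℝ × ℝ)).map (fun p => (p.1, p.2.1)) := by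
  rw [regroup, Measure.fst, Measure.map_map measurable_fst (by fun_prop)]
  rfl

/-- When `y` takes two values, the law of `(x, y)` is determined by the law of `x`. -/
theorem regroup_fst_eq {μX μY μZ : Measure ℝ} {X Y Z : Set ℝ}
    (hX : IsCompact X) (hY : IsCompact Y) (hZ : IsCompact Z) (hμX : μX Xᶜ = 0) (hμY : μY Yᶜ = 0)
    (hμZ : μZ Zᶜ = 0) {y₁ y₂ : ℝ} (hy : y₁ < y₂) (hyy : μY {y₁, y₂}ᶜ = 0)
    {π π' : ProbabilityMeasure (ℝ × ℝ × ℝ)} (hπ : π ∈ Couplings μX μY μZ)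
    (hM : MartingaleTests (π : Measure (ℝ × ℝ × ℝ))) (hπ' : π' ∈ Couplings μX μY μZ)
    (hM' : MartingaleTests (π' : Measure (ℝ × ℝ × ℝ))) :
    (regroup π).fst = (regroup π').fst := by
  refine ext_of_forall_integral_eq_of_IsFiniteMeasure fun h => ?_
  have h1 := integral_fst_snd_of_martingaleTests hX hY hZ hμX hμY hμZ hyy hπ hM h.continuous
  have h2 := integral_fst_snd_of_martingaleTests hX hY hZ hμX hμY hμZ hyy hπ' hM' h.continuous
  have h3 := mul_left_cancel₀ (sub_pos.2 hy).ne' (h1.trans h2.symm)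
  rw [regroup_fst, regroup_fst, integral_map (by fun_prop) h.continuous.aestronglyMeasurable,
    integral_map (by fun_prop) h.continuous.aestronglyMeasurable]
  exact h3

/-- The midpoint dominates both couplings, so sets null for its conditional laws will be null for
theirs. -/
theorem exists_average {μX μY μZ : Measure ℝ} {X Y Z : Set ℝ}
    (hX : IsCompact X) (hY : IsCompact Y) (hZ : IsCompact Z) (hμX : μX Xᶜ = 0) (hμY : μY Yᶜ = 0)
    (hμZ : μZ Zᶜ = 0)
    {π π' : ProbabilityMeasure (ℝ × ℝ × ℝ)} (hπ : π ∈ Couplings μX μY μZ)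
    (hM : MartingaleTests (π : Measure (ℝ × ℝ × ℝ))) (hπ' : π' ∈ Couplings μX μY μZ)
    (hM' : MartingaleTests (π' : Measure (ℝ × ℝ × ℝ))) :
    ∃ π'' ∈ Couplings μX μY μZ, MartingaleTests (π'' : Measure (ℝ × ℝ × ℝ)) ∧
      (∀ F : ℝ × ℝ × ℝ → ℝ, Continuous F → ∫ p, F p ∂(π'' : Measure (ℝ × ℝ × ℝ)) =
        2⁻¹ * ∫ p, F p ∂(π : Measure (ℝ × ℝ × ℝ)) + 2⁻¹ * ∫ p, F p ∂(π' : Measure (ℝ × ℝ × ℝ))) ∧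
      regroup π ≪ regroup π'' ∧ regroup π' ≪ regroup π'' := by
  have hK : IsCompact (X ×ˢ Y ×ˢ Z) := hX.prod (hY.prod hZ)
  have hae := Couplings.ae_mem hπ hX.measurableSet hY.measurableSet hZ.measurableSet hμX hμY hμZ
  have hae' := Couplings.ae_mem hπ' hX.measurableSet hY.measurableSet hZ.measurableSet hμX hμY hμZ
  have half : (2⁻¹ : ℝ≥0) + 2⁻¹ = 1 := by
    rw [← NNReal.coe_inj]; push_cast; norm_num
  set ν : Measure (ℝ × ℝ × ℝ) := (2⁻¹ : ℝ≥0) • (π : Measure (ℝ × ℝ × ℝ)) +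
    (2⁻¹ : ℝ≥0) • (π' : Measure (ℝ × ℝ × ℝ)) with hν
  have hmap : ∀ (f : ℝ × ℝ × ℝ → ℝ) (μ : Measure ℝ), Measurable f →
      (π : Measure (ℝ × ℝ × ℝ)).map f = μ → (π' : Measure (ℝ × ℝ × ℝ)).map f = μ →
      ν.map f = μ := by
    intro f μ hf h h'
    rw [hν, Measure.map_add _ _ hf, Measure.map_smul, Measure.map_smul, h, h', ← add_smul, half,
      one_smul]
  have hprob : IsProbabilityMeasure ν := by
    constructor
    rw [hν, Measure.add_apply, Measure.smul_apply, Measure.smul_apply, measure_univ, measure_univ,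
      ← add_smul, half, one_smul]
  have hint : ∀ F : ℝ × ℝ × ℝ → ℝ, Continuous F → ∫ p, F p ∂ν =
        2⁻¹ * ∫ p, F p ∂(π : Measure (ℝ × ℝ × ℝ)) +
        2⁻¹ * ∫ p, F p ∂(π' : Measure (ℝ × ℝ × ℝ)) := by
    intro F hF
    rw [hν, integral_add_measure
      ((hF.integrable_of_ae_mem_isCompact hK hae).smul_measure_nnreal)
      ((hF.integrable_of_ae_mem_isCompact hK hae').smul_measure_nnreal),
      integral_smul_nnreal_measure, integral_smul_nnreal_measure]
    simp [NNReal.smul_def]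
  have hac : ∀ π₀ : ProbabilityMeasure (ℝ × ℝ × ℝ),
      (2⁻¹ : ℝ≥0) • (π₀ : Measure (ℝ × ℝ × ℝ)) ≤ ν →
      regroup π₀ ≪ regroup (⟨ν, hprob⟩ : ProbabilityMeasure (ℝ × ℝ × ℝ)) := by
    intro π₀ h0
    refine Measure.AbsolutelyContinuous.map ?_ (by fun_prop)
    refine Measure.AbsolutelyContinuous.trans ?_ (Measure.absolutelyContinuous_of_le h0)
    intro s hs
    simpa using hs
  refine ⟨⟨ν, hprob⟩, ⟨hmap _ _ (by fun_prop) hπ.1 hπ'.1, hmap _ _ (by fun_prop) hπ.2.1 hπ'.2.1,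
    hmap _ _ (by fun_prop) hπ.2.2 hπ'.2.2⟩, ⟨?_, ?_⟩, hint, hac π ?_, hac π' ?_⟩
  · intro g hg
    refine (hint _ (by fun_prop)).trans ?_
    rw [hM.1 g hg, hM'.1 g hg]
    simp
  · intro g hg
    refine (hint _ (by fun_prop)).trans ?_
    rw [hM.2 g hg, hM'.2 g hg]
    simp
  · exact Measure.le_add_right le_rfl
  · exact Measure.le_add_left le_rfl

/-- Uniqueness of the optimal martingale coupling when `y` takes two values. -/
theorem eq_of_optimal {μX μY μZ : Measure ℝ} {xlo xhi : ℝ} {Y Z : Set ℝ}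
    (hY : IsCompact Y) (hZ : IsCompact Z) (hμX : μX (Icc xlo xhi)ᶜ = 0) (hμY : μY Yᶜ = 0)
    (hμZ : μZ Zᶜ = 0) (hatoms : ∀ x : ℝ, μX {x} = 0) {y₁ y₂ : ℝ} (hy : y₁ < y₂)
    (hyy : μY {y₁, y₂}ᶜ = 0)
    {C₁ C₂ C₃ : ℝ × ℝ → ℝ} (hC₁ : Continuous C₁) (hC₂ : Continuous C₂) (hC₃ : Continuous C₃)
    {c₃ : ℝ → ℝ → ℝ} (hc₃ : ∀ x ∈ Icc xlo xhi, ∀ z ∈ Z, C₃ (x, z) = c₃ x z)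
    (hSM : MartingaleSpenceMirrlees (Icc xlo xhi) Z c₃)
    {π π' : ProbabilityMeasure (ℝ × ℝ × ℝ)}
    (ho : IsOptimalMOT (fun x y z => C₁ (x, y) + C₂ (y, z) + C₃ (x, z)) μX μY μZ π)
    (ho' : IsOptimalMOT (fun x y z => C₁ (x, y) + C₂ (y, z) + C₃ (x, z)) μX μY μZ π') :
    π = π' := by
  have hmem := fun π₀ => mem_martingaleCouplings_iff isCompact_Icc hY hZ hμX hμY hμZ π₀
  obtain ⟨hπ, hM⟩ := (hmem π).1 ho.1
  obtain ⟨hπ', hM'⟩ := (hmem π').1 ho'.1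
  obtain ⟨σ, hσ, hMσ, hint, hac, hac'⟩ := exists_average isCompact_Icc hY hZ hμX hμY hμZ
    hπ hM hπ' hM'
  have hfst : (regroup π).fst = (regroup σ).fst :=
    regroup_fst_eq isCompact_Icc hY hZ hμX hμY hμZ hy hyy hπ hM hσ hMσ
  have hfst' : (regroup π').fst = (regroup σ).fst :=
    regroup_fst_eq isCompact_Icc hY hZ hμX hμY hμZ hy hyy hπ' hM' hσ hMσ
  -- The midpoint is optimal since its cost is the average of two minimal costs.
  have hpair := ae_exists_pair_of_optimal hY hZ hμX hμY hμZ hatoms hyy hσ hMσ hC₁ hC₂ hC₃ hc₃ hSM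
    (fun π₀ h₀ h₀' => by
      rw [hint _ (by fun_prop)]
      have h1 := ho.2 π₀ ((hmem π₀).2 ⟨h₀, h₀'⟩)
      have h2 := ho'.2 π₀ ((hmem π₀).2 ⟨h₀, h₀'⟩)
      linarith) ((regroup σ).disintegrate (regroup σ).condKernel).symm
  have hd : regroup π = (regroup σ).fst ⊗ₘ (regroup π).condKernel := by
    rw [← hfst, (regroup π).disintegrate]
  have hd' : regroup π' = (regroup σ).fst ⊗ₘ (regroup π').condKernel := by
    rw [← hfst', (regroup π').disintegrate]
  -- With a common law of `(x, y)`, absolute continuity descends to the conditional laws of `z`.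
  have hk : ∀ᵐ p ∂(regroup σ).fst,
      (regroup π).condKernel p ≪ (regroup σ).condKernel p := by
    refine Measure.AbsolutelyContinuous.kernel_of_compProd (ν := (regroup σ).fst) ?_
    rwa [← hd, (regroup σ).disintegrate]
  have hk' : ∀ᵐ p ∂(regroup σ).fst,
      (regroup π').condKernel p ≪ (regroup σ).condKernel p := by
    refine Measure.AbsolutelyContinuous.kernel_of_compProd (ν := (regroup σ).fst) ?_
    rwa [← hd', (regroup σ).disintegrate]
  have hb := ho.1.2.2
  have hb' := ho'.1.2.2
  rw [hfst] at hb
  rw [hfst'] at hb'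
  refine regroup_injective ?_
  rw [hd, hd']
  refine Measure.compProd_congr ?_
  filter_upwards [hpair, hk, hk', hb, hb'] with p h1 h2 h3 h4 h5
  obtain ⟨a, b, hab⟩ := h1
  exact eq_of_ae_pair_of_integral_eq (h2.ae_le hab) (h3.ae_le hab) (h4.trans h5.symm)

/-! ### Construction of a martingale coupling. -/

/-- A law on `Z₋ ∪ Z₊` whose mean is a mixture of two points of the gap splits into laws having
these points as means. -/
theorem exists_splitting_of_gap (μ : Measure ℝ) [IsProbabilityMeasure μ]
    {zmlo zmhi zplo zphi : ℝ} (hμ : μ (Icc zmlo zmhi ∪ Icc zplo zphi)ᶜ = 0)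
    {y₁ y₂ : ℝ} (h1 : zmhi < y₁) (h12 : y₁ < y₂) (h2 : y₂ < zplo) (a₁ a₂ : ℝ≥0)
    (ha : a₁ + a₂ = 1) (hmean : ∫ z, z ∂μ = a₁ * y₁ + a₂ * y₂) :
    ∃ ζ₁ ζ₂ : Measure ℝ, IsProbabilityMeasure ζ₁ ∧ IsProbabilityMeasure ζ₂ ∧
      ζ₁ ≪ μ ∧ ζ₂ ≪ μ ∧
      ∫ z, z ∂ζ₁ = y₁ ∧ ∫ z, z ∂ζ₂ = y₂ ∧ a₁ • ζ₁ + a₂ • ζ₂ = μ := by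
  have haR : (a₁ : ℝ) + a₂ = 1 := by exact_mod_cast ha
  set A := Icc zmlo zmhi with hA
  set B := Icc zplo zphi with hB
  have hdisj : Disjoint A B := by
    rw [Set.disjoint_left]
    intro z hz hz'
    linarith [hz.2, hz'.1]
  have hae : ∀ᵐ z ∂μ, z ∈ A ∪ B := hμ
  have hsplit : μ.restrict A + μ.restrict B = μ := by
    rw [← Measure.restrict_union hdisj measurableSet_Icc]
    exact Measure.restrict_eq_self_of_ae_mem hae
  have hint : Integrable (fun z : ℝ => z) μ := Continuous.integrable_of_ae_mem_isCompact
    (isCompact_Icc.union isCompact_Icc) hae continuous_id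
  set p := μ.real A with hp
  set q := μ.real B with hq
  set m := ∫ z in A, z ∂μ with hm
  set n := ∫ z in B, z ∂μ with hn
  have hpq : p + q = 1 := by
    rw [hp, hq, ← measureReal_union hdisj measurableSet_Icc]
    have h3 : μ (A ∪ B) = 1 := (prob_compl_eq_zero_iff (measurableSet_Icc.union
      measurableSet_Icc)).1 hμ
    simp [Measure.real, h3]
  have hmn : m + n = a₁ * y₁ + a₂ * y₂ := by
    rw [← hmean, hm, hn, ← integral_add_measure hint.restrict hint.restrict, hsplit]
  have hp0 : 0 ≤ p := measureReal_nonneg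
  have hq0 : 0 ≤ q := measureReal_nonneg
  have hm_le : m ≤ zmhi * p := by
    calc m ≤ ∫ _ in A, zmhi ∂μ := setIntegral_mono_on hint.integrableOn
            (integrable_const _) measurableSet_Icc (fun z hz => hz.2)
      _ = zmhi * p := by simp [hp, mul_comm]
  have hn_ge : zplo * q ≤ n := by
    calc zplo * q = ∫ _ in B, zplo ∂μ := by simp [hq, mul_comm]
      _ ≤ n := setIntegral_mono_on (integrable_const _) hint.integrableOn
            measurableSet_Icc (fun z hz => hz.1)
  have hm_zero : p = 0 → m = 0 := fun h =>
    setIntegral_measure_zero _ ((measureReal_eq_zero_iff).1 h)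
  have hn_zero : q = 0 → n = 0 := fun h =>
    setIntegral_measure_zero _ ((measureReal_eq_zero_iff).1 h)
  have ha₁ := a₁.coe_nonneg
  have ha₂ := a₂.coe_nonneg
  have hmid1 : y₁ ≤ m + n := by
    have := mul_nonneg ha₂ (sub_nonneg.2 h12.le)
    linear_combination this - hmn - y₁ * haR
  have hmid2 : m + n ≤ y₂ := by
    have := mul_nonneg ha₁ (sub_nonneg.2 h12.le)
    linear_combination this + hmn + y₂ * haR
  have hppos : 0 < p := by
    refine lt_of_le_of_ne hp0 fun h => ?_
    have e := hm_zero h.symm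
    have : q = 1 := by linarith
    rw [this] at hn_ge
    linarith
  have hqpos : 0 < q := by
    refine lt_of_le_of_ne hq0 fun h => ?_
    have e := hn_zero h.symm
    have : p = 1 := by linarith
    rw [this] at hm_le
    linarith
  -- This is `p * q` times the difference of the means `n / q` and `m / p` of the two halves.
  have hΔ : 0 < p * n - q * m := by nlinarith [mul_pos hppos hqpos]
  have hne := hΔ.ne'
  -- Cramer's rule for `α * p + β * q = 1`, `α * m + β * n = y`. The solution is nonnegative because
  -- `y` lies in the gap, hence between the means of the two halves.
  have key : ∀ y : ℝ, y₁ ≤ y → y ≤ y₂ → ∃ α β : ℝ≥0, (α : ℝ) = (n - y * q) / (p * n - q * m) ∧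
      (β : ℝ) = (y * p - m) / (p * n - q * m) := by
    intro y hy1 hy2
    refine ⟨⟨(n - y * q) / (p * n - q * m), div_nonneg ?_ hΔ.le⟩,
      ⟨(y * p - m) / (p * n - q * m), div_nonneg ?_ hΔ.le⟩, rfl, rfl⟩
    · nlinarith
    · nlinarith
  have build : ∀ (y : ℝ) (α β : ℝ≥0), (α : ℝ) = (n - y * q) / (p * n - q * m) →
      (β : ℝ) = (y * p - m) / (p * n - q * m) →
      IsProbabilityMeasure (α • μ.restrict A + β • μ.restrict B) ∧
      (α • μ.restrict A + β • μ.restrict B) ≪ μ ∧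
      ∫ z, z ∂(α • μ.restrict A + β • μ.restrict B) = y := by
    intro y α β hα hβ
    refine ⟨⟨?_⟩, ?_, ?_⟩
    · have : (α • μ.restrict A + β • μ.restrict B).real univ = 1 := by
        have e : (α • μ.restrict A + β • μ.restrict B).real univ = α * p + β * q := by
          rw [measureReal_add_apply, measureReal_nnreal_smul_apply, measureReal_nnreal_smul_apply,
            measureReal_restrict_apply_univ, measureReal_restrict_apply_univ]
        rw [e, hα, hβ, div_mul_eq_mul_div, div_mul_eq_mul_div, ← add_div, div_eq_iff hne]
        ring
      exact (ENNReal.toReal_eq_one_iff _).1 this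
    · refine Measure.AbsolutelyContinuous.add_left ?_ ?_
      · exact Measure.absolutelyContinuous_restrict.smul_left α
      · exact Measure.absolutelyContinuous_restrict.smul_left β
    · rw [integral_add_measure hint.restrict.smul_measure_nnreal
        hint.restrict.smul_measure_nnreal, integral_smul_nnreal_measure,
        integral_smul_nnreal_measure, ← hm, ← hn, NNReal.smul_def, NNReal.smul_def, hα, hβ,
        smul_eq_mul, smul_eq_mul, div_mul_eq_mul_div, div_mul_eq_mul_div, ← add_div,
        div_eq_iff hne]
      ring
  obtain ⟨α₁, β₁, hα₁, hβ₁⟩ := key y₁ le_rfl h12.le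
  obtain ⟨α₂, β₂, hα₂, hβ₂⟩ := key y₂ h12.le le_rfl
  obtain ⟨b1, b2, b3⟩ := build y₁ α₁ β₁ hα₁ hβ₁
  obtain ⟨c1, c2, c3⟩ := build y₂ α₂ β₂ hα₂ hβ₂
  refine ⟨_, _, b1, c1, b2, c2, b3, c3, ?_⟩
  -- The weights are affine in `y`, and at the overall mean `m + n` both equal `1`.
  have eα : a₁ * α₁ + a₂ * α₂ = 1 := by
    rw [← NNReal.coe_inj]
    push_cast
    rw [hα₁, hα₂, ← mul_div_assoc, ← mul_div_assoc, ← add_div, div_eq_one_iff_eq hne]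
    have e1 : (a₂ : ℝ) = 1 - a₁ := by linarith
    have e2 : p = 1 - q := by linarith
    rw [e1] at hmn ⊢
    rw [e2]
    linear_combination q * hmn
  have eβ : a₁ * β₁ + a₂ * β₂ = 1 := by
    rw [← NNReal.coe_inj]
    push_cast
    rw [hβ₁, hβ₂, ← mul_div_assoc, ← mul_div_assoc, ← add_div, div_eq_one_iff_eq hne]
    have e1 : (a₂ : ℝ) = 1 - a₁ := by linarith
    have e2 : q = 1 - p := by linarith
    rw [e1] at hmn ⊢
    rw [e2]
    linear_combination (-p) * hmn
  calc a₁ • (α₁ • μ.restrict A + β₁ • μ.restrict B) + a₂ • (α₂ • μ.restrict A + β₂ • μ.restrict B)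
      = (a₁ * α₁ + a₂ * α₂) • μ.restrict A + (a₁ * β₁ + a₂ * β₂) • μ.restrict B := by
        simp only [smul_add, add_smul, mul_smul]
        abel
    _ = μ := by rw [eα, eβ, one_smul, one_smul, hsplit]

theorem ConvexOrder.integral_id_eq {μ ν : Measure ℝ} (h : ConvexOrder μ ν) :
    ∫ x, x ∂μ = ∫ x, x ∂ν := by
  refine le_antisymm (h (fun x => x) (convexOn_id convex_univ)) ?_
  have := h (fun x => -x) (concaveOn_id convex_univ).neg
  rw [integral_neg, integral_neg] at this
  linarith

/-- A compactly supported law dominated in convex order by a law on `{y₁, y₂}` lives on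
`[y₁, y₂]`. -/
theorem ConvexOrder.ae_mem_Icc {μ ν : Measure ℝ} [IsFiniteMeasure μ] (h : ConvexOrder μ ν)
    {X : Set ℝ} (hX : IsCompact X) (hμ : μ Xᶜ = 0) {y₁ y₂ : ℝ} (hy : y₁ ≤ y₂)
    (hν : ∀ᵐ y ∂ν, y = y₁ ∨ y = y₂) : ∀ᵐ x ∂μ, x ∈ Icc y₁ y₂ := by
  -- The test function is the distance to `[y₁, y₂]`, which vanishes at both atoms of `ν`.
  have hconv : ConvexOn ℝ univ (fun x : ℝ => max (y₁ - x) 0 + max (x - y₂) 0) := by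
    refine ConvexOn.add (ConvexOn.sup ?_ (convexOn_const _ convex_univ))
      (ConvexOn.sup ?_ (convexOn_const _ convex_univ))
    · exact (convexOn_const _ convex_univ).sub (concaveOn_id convex_univ)
    · exact (convexOn_id convex_univ).sub (concaveOn_const _ convex_univ)
  have h1 := h _ hconv
  have h2 : ∫ x, (max (y₁ - x) 0 + max (x - y₂) 0) ∂ν = 0 := by
    refine integral_eq_zero_of_ae ?_
    filter_upwards [hν] with y hy'
    rcases hy' with rfl | rfl <;> simp [hy]
  rw [h2] at h1
  have hpos : ∀ x : ℝ, 0 ≤ max (y₁ - x) 0 + max (x - y₂) 0 := fun x =>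
    add_nonneg (le_max_right _ _) (le_max_right _ _)
  have h3 := (integral_eq_zero_iff_of_nonneg hpos (Continuous.integrable_of_ae_mem_isCompact hX hμ
    (by fun_prop))).1 (le_antisymm h1 (integral_nonneg hpos))
  filter_upwards [h3] with x hx
  simp only [Pi.zero_apply] at hx
  have e1 := le_max_left (y₁ - x) 0
  have e2 := le_max_right (y₁ - x) 0
  have e3 := le_max_left (x - y₂) 0
  have e4 := le_max_right (x - y₂) 0
  exact ⟨by linarith, by linarith⟩

/-- Existence of a martingale coupling when the intermediate law has two atoms. -/
theorem exists_martingale_coupling {μX μY μZ : Measure ℝ} [IsProbabilityMeasure μX]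
    [IsProbabilityMeasure μZ] {X : Set ℝ} (hX : IsCompact X) (hμX : μX Xᶜ = 0)
    {Z : Set ℝ} (hZ : IsCompact Z) (hμZ : μZ Zᶜ = 0)
    {y₁ y₂ : ℝ} (hy : y₁ < y₂) {a₁ a₂ : ℝ≥0}
    (hμY : μY = a₁ • Measure.dirac y₁ + a₂ • Measure.dirac y₂) (ha : a₁ + a₂ = 1)
    (hx : ∀ᵐ x ∂μX, x ∈ Icc y₁ y₂) (hmean : ∫ x, x ∂μX = a₁ * y₁ + a₂ * y₂)
    {ζ₁ ζ₂ : Measure ℝ} [IsProbabilityMeasure ζ₁] [IsProbabilityMeasure ζ₂]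
    (hζ₁ : ζ₁ ≪ μZ) (hζ₂ : ζ₂ ≪ μZ) (hm₁ : ∫ z, z ∂ζ₁ = y₁) (hm₂ : ∫ z, z ∂ζ₂ = y₂)
    (hsum : a₁ • ζ₁ + a₂ • ζ₂ = μZ) :
    ∃ π ∈ Couplings μX μY μZ, MartingaleTests (π : Measure (ℝ × ℝ × ℝ)) := by
  have haR : (a₁ : ℝ) + a₂ = 1 := by exact_mod_cast ha
  have hyne : y₂ - y₁ ≠ 0 := (sub_pos.2 hy).ne'
  have hXae : ∀ᵐ x ∂μX, x ∈ X := hμX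
  have cX : ∀ f : ℝ → ℝ, Continuous f → Integrable f μX := fun f hf =>
    hf.integrable_of_ae_mem_isCompact hX hXae
  -- The conditional probabilities of `y₁` and `y₂` given `x` that have mean `x`.
  set w₁ : ℝ → ℝ := fun x => (y₂ - x) / (y₂ - y₁) with hw₁
  set w₂ : ℝ → ℝ := fun x => (x - y₁) / (y₂ - y₁) with hw₂
  have cw₁ : Continuous w₁ := by fun_prop
  have cw₂ : Continuous w₂ := by fun_prop
  have pw₁ : ∀ᵐ x ∂μX, 0 ≤ w₁ x := by
    filter_upwards [hx] with x hx using div_nonneg (by linarith [hx.2]) (by linarith)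
  have pw₂ : ∀ᵐ x ∂μX, 0 ≤ w₂ x := by
    filter_upwards [hx] with x hx using div_nonneg (by linarith [hx.1]) (by linarith)
  set ξ₁ := μX.withDensity fun x => ENNReal.ofReal (w₁ x) with hξ₁
  set ξ₂ := μX.withDensity fun x => ENNReal.ofReal (w₂ x) with hξ₂
  have hξ : ξ₁ + ξ₂ = μX := by
    rw [hξ₁, hξ₂, ← withDensity_add_left (by fun_prop)]
    conv_rhs => rw [← withDensity_one (μ := μX)]
    refine withDensity_congr_ae ?_
    filter_upwards [pw₁, pw₂] with x h1 h2
    rw [Pi.add_apply, ← ENNReal.ofReal_add h1 h2, Pi.one_apply, hw₁, hw₂, ← add_div]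
    rw [show y₂ - x + (x - y₁) = y₂ - y₁ by ring, div_self hyne, ENNReal.ofReal_one]
  have mass : ∀ w : ℝ → ℝ, Continuous w → (∀ᵐ x ∂μX, 0 ≤ w x) → ∀ a : ℝ≥0,
      ∫ x, w x ∂μX = a → (μX.withDensity fun x => ENNReal.ofReal (w x)) univ = a := by
    intro w hw hpos a h
    rw [withDensity_apply _ MeasurableSet.univ, Measure.restrict_univ,
      ← ofReal_integral_eq_lintegral_ofReal (cX w hw) hpos, h, ENNReal.ofReal_coe_nnreal]
  have hξ₁m : ξ₁ univ = a₁ := by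
    refine mass w₁ cw₁ pw₁ a₁ ?_
    rw [hw₁, integral_div, integral_sub (integrable_const _) (cX (fun x => x) continuous_id), hmean]
    simp only [integral_const, probReal_univ, one_smul]
    rw [div_eq_iff hyne]
    linear_combination (-y₂) * haR
  have hξ₂m : ξ₂ univ = a₂ := by
    refine mass w₂ cw₂ pw₂ a₂ ?_
    rw [hw₂, integral_div, integral_sub (cX (fun x => x) continuous_id) (integrable_const _), hmean]
    simp only [integral_const, probReal_univ, one_smul]
    rw [div_eq_iff hyne]
    linear_combination y₁ * haR
  have f₁ : IsFiniteMeasure ξ₁ := ⟨by rw [hξ₁m]; exact ENNReal.coe_lt_top⟩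
  have f₂ : IsFiniteMeasure ξ₂ := ⟨by rw [hξ₂m]; exact ENNReal.coe_lt_top⟩
  have iξ : ∀ w : ℝ → ℝ, Continuous w → (∀ᵐ x ∂μX, 0 ≤ w x) → ∀ f : ℝ → ℝ,
      ∫ x, f x ∂(μX.withDensity fun x => ENNReal.ofReal (w x)) = ∫ x, w x * f x ∂μX := by
    intro w hw hpos f
    rw [integral_withDensity_eq_integral_toReal_smul (by fun_prop) (by simp)]
    refine integral_congr_ae ?_
    filter_upwards [hpos] with x hx
    simp [ENNReal.toReal_ofReal hx]
  have aξ₁ : ξ₁ ≪ μX := withDensity_absolutelyContinuous _ _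
  have aξ₂ : ξ₂ ≪ μX := withDensity_absolutelyContinuous _ _
  have hm : ∀ y : ℝ, Measurable (fun q : ℝ × ℝ => (q.1, y, q.2)) := fun y => by fun_prop
  -- Given `y`, the variables `x` and `z` are independent, so the mean of `z` given `(x, y)` is that
  -- of `ζ₁` or `ζ₂`, namely `y`.
  set ν : Measure (ℝ × ℝ × ℝ) := (ξ₁.prod ζ₁).map (fun q => (q.1, y₁, q.2)) +
    (ξ₂.prod ζ₂).map (fun q => (q.1, y₂, q.2)) with hν
  have prodK : ∀ ξ ζ : Measure ℝ, IsFiniteMeasure ξ → IsFiniteMeasure ζ → ξ ≪ μX → ζ ≪ μZ →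
      ∀ᵐ q ∂(ξ.prod ζ), q ∈ X ×ˢ Z := by
    intro ξ ζ _ _ h1 h2
    have e1 : ∀ᵐ q ∂(ξ.prod ζ), q.1 ∈ X :=
      Measure.quasiMeasurePreserving_fst.ae (h1.ae_le hXae)
    have e2 : ∀ᵐ q ∂(ξ.prod ζ), q.2 ∈ Z :=
      Measure.quasiMeasurePreserving_snd.ae (h2.ae_le hμZ)
    filter_upwards [e1, e2] with q q1 q2 using ⟨q1, q2⟩
  have cP : ∀ ξ ζ : Measure ℝ, IsFiniteMeasure ξ → IsFiniteMeasure ζ → ξ ≪ μX → ζ ≪ μZ →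
      ∀ F : ℝ × ℝ → ℝ, Continuous F → Integrable F (ξ.prod ζ) := fun ξ ζ h1 h2 h3 h4 F hF =>
    hF.integrable_of_ae_mem_isCompact (hX.prod hZ) (prodK ξ ζ h1 h2 h3 h4)
  have hintν : ∀ F : ℝ × ℝ × ℝ → ℝ, Continuous F → ∫ p, F p ∂ν =
      ∫ q, F (q.1, y₁, q.2) ∂(ξ₁.prod ζ₁) + ∫ q, F (q.1, y₂, q.2) ∂(ξ₂.prod ζ₂) := by
    intro F hF
    rw [hν, integral_add_measure, integral_map (hm _).aemeasurable hF.aestronglyMeasurable,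
      integral_map (hm _).aemeasurable hF.aestronglyMeasurable]
    · rw [integrable_map_measure hF.aestronglyMeasurable (hm _).aemeasurable]
      exact cP _ _ f₁ inferInstance aξ₁ hζ₁ _ (by fun_prop)
    · rw [integrable_map_measure hF.aestronglyMeasurable (hm _).aemeasurable]
      exact cP _ _ f₂ inferInstance aξ₂ hζ₂ _ (by fun_prop)
  have mx : ν.map (fun p => p.1) = μX := by
    rw [hν, Measure.map_add _ _ (by fun_prop), Measure.map_map (by fun_prop) (hm _),
      Measure.map_map (by fun_prop) (hm _)]
    change (ξ₁.prod ζ₁).map Prod.fst + (ξ₂.prod ζ₂).map Prod.fst = μX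
    rw [Measure.map_fst_prod, Measure.map_fst_prod, measure_univ, measure_univ, one_smul, one_smul,
      hξ]
  have my : ν.map (fun p => p.2.1) = μY := by
    rw [hν, Measure.map_add _ _ (by fun_prop), Measure.map_map (by fun_prop) (hm _),
      Measure.map_map (by fun_prop) (hm _)]
    change (ξ₁.prod ζ₁).map (fun _ => y₁) + (ξ₂.prod ζ₂).map (fun _ => y₂) = μY
    rw [Measure.map_const, Measure.map_const, ← univ_prod_univ, Measure.prod_prod,
      Measure.prod_prod, measure_univ (μ := ζ₁), measure_univ (μ := ζ₂), mul_one, mul_one, hξ₁m, hξ₂m, hμY]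
    rfl
  have mz : ν.map (fun p => p.2.2) = μZ := by
    rw [hν, Measure.map_add _ _ (by fun_prop), Measure.map_map (by fun_prop) (hm _),
      Measure.map_map (by fun_prop) (hm _)]
    change (ξ₁.prod ζ₁).map Prod.snd + (ξ₂.prod ζ₂).map Prod.snd = μZ
    rw [Measure.map_snd_prod, Measure.map_snd_prod, hξ₁m, hξ₂m, ← hsum]
    rfl
  have hprob : IsProbabilityMeasure ν := by
    constructor
    have h1 := congrArg (fun m => m univ) mx
    simpa only [Measure.map_apply (measurable_fst : Measurable fun p : ℝ × ℝ × ℝ => p.1)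
      MeasurableSet.univ, preimage_univ, measure_univ] using h1
  refine ⟨⟨ν, hprob⟩, ⟨mx, my, mz⟩, ?_, ?_⟩
  · intro g hg
    refine (hintν _ (by fun_prop)).trans ?_
    have e : ∀ (ξ ζ : Measure ℝ) (_ : IsFiniteMeasure ξ) (_ : IsProbabilityMeasure ζ) (y : ℝ),
        ∫ q, g q.1 * (y - q.1) ∂(ξ.prod ζ) = ∫ x, g x * (y - x) ∂ξ := by
      intro ξ ζ _ _ y
      simpa using integral_prod_mul (μ := ξ) (ν := ζ) (fun x => g x * (y - x)) (fun _ => (1 : ℝ))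
    rw [e ξ₁ ζ₁ f₁ inferInstance, e ξ₂ ζ₂ f₂ inferInstance, hξ₁, hξ₂, iξ w₁ cw₁ pw₁,
      iξ w₂ cw₂ pw₂, ← integral_add (cX _ (by fun_prop)) (cX _ (by fun_prop))]
    refine integral_eq_zero_of_ae (Filter.Eventually.of_forall fun x => ?_)
    simp only [hw₁, hw₂, Pi.zero_apply]
    field_simp
    ring
  · intro g hg
    refine (hintν _ (by fun_prop)).trans ?_
    have e : ∀ (ξ ζ : Measure ℝ) (_ : IsFiniteMeasure ξ) (_ : IsProbabilityMeasure ζ) (y : ℝ),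
        ζ ≪ μZ → ∫ z, z ∂ζ = y → ∫ q, g (q.1, y) * (q.2 - y) ∂(ξ.prod ζ) = 0 := by
      intro ξ ζ _ _ y hac hy
      have hi : Integrable (fun z : ℝ => z) ζ :=
        Continuous.integrable_of_ae_mem_isCompact hZ (hac.ae_le hμZ) continuous_id
      rw [integral_prod_mul (μ := ξ) (ν := ζ) (fun x => g (x, y)) (fun z => z - y),
        integral_sub hi (integrable_const _), hy]
      simp
    rw [e ξ₁ ζ₁ f₁ inferInstance y₁ hζ₁ hm₁, e ξ₂ ζ₂ f₂ inferInstance y₂ hζ₂ hm₂, add_zero]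

/-! ### Existence of a minimizer. -/

/-- Weak convergence tests bounded functions only; truncation leaves integrals against measures
carried by `K` unchanged. -/
theorem exists_boundedContinuous_eqOn_isCompact {α : Type*} [TopologicalSpace α] {K : Set α}
    (hK : IsCompact K) {F : α → ℝ} (hF : Continuous F) :
    ∃ G : BoundedContinuousFunction α ℝ, ∀ p ∈ K, G p = F p := by
  obtain ⟨B, hB⟩ := hK.exists_bound_of_continuousOn hF.continuousOn
  refine ⟨BoundedContinuousFunction.mkOfBound ⟨fun p => max (-B) (min (F p) B), by fun_prop⟩
    (2 * |B|) ?_, ?_⟩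
  · intro x y
    have h : ∀ p, |max (-B) (min (F p) B)| ≤ |B| := by
      intro p
      rw [abs_le]
      have h1 := neg_abs_le B
      have h2 := le_abs_self B
      exact ⟨le_max_of_le_left (by linarith), max_le (by linarith)
        ((min_le_right _ _).trans h2)⟩
    change |max (-B) (min (F x) B) - max (-B) (min (F y) B)| ≤ _
    have := abs_sub (max (-B) (min (F x) B)) (max (-B) (min (F y) B))
    linarith [h x, h y]
  · intro p hp
    have h := abs_le.1 (hB p hp)
    change max (-B) (min (F p) B) = F p
    rw [min_eq_left h.2, max_eq_right h.1]

/-- A continuous cost attains its minimum over the martingale couplings. -/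
theorem exists_optimal {μX μY μZ : Measure ℝ} [IsProbabilityMeasure μX]
    [IsProbabilityMeasure μY] [IsProbabilityMeasure μZ] {X Y Z : Set ℝ}
    (hX : IsCompact X) (hY : IsCompact Y) (hZ : IsCompact Z) (hμX : μX Xᶜ = 0) (hμY : μY Yᶜ = 0)
    (hμZ : μZ Zᶜ = 0)
    (hne : ∃ π ∈ Couplings μX μY μZ, MartingaleTests (π : Measure (ℝ × ℝ × ℝ)))
    {C : ℝ × ℝ × ℝ → ℝ} (hC : Continuous C) :
    ∃ π ∈ Couplings μX μY μZ, MartingaleTests (π : Measure (ℝ × ℝ × ℝ)) ∧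
      ∀ π' ∈ Couplings μX μY μZ, MartingaleTests (π' : Measure (ℝ × ℝ × ℝ)) →
      ∫ p, C p ∂(π : Measure (ℝ × ℝ × ℝ)) ≤ ∫ p, C p ∂(π' : Measure (ℝ × ℝ × ℝ)) := by
  have hK : IsCompact (X ×ˢ Y ×ˢ Z) := hX.prod (hY.prod hZ)
  have hae : ∀ π ∈ Couplings μX μY μZ, ∀ᵐ p ∂(π : Measure (ℝ × ℝ × ℝ)), p ∈ X ×ˢ Y ×ˢ Z :=
    fun π hπ => Couplings.ae_mem hπ hX.measurableSet hY.measurableSet hZ.measurableSet hμX hμY hμZ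
  have hcont : ∀ F : ℝ × ℝ × ℝ → ℝ, Continuous F →
      ContinuousOn (fun π : ProbabilityMeasure (ℝ × ℝ × ℝ) =>
        ∫ p, F p ∂(π : Measure (ℝ × ℝ × ℝ))) (Couplings μX μY μZ) := by
    intro F hF
    obtain ⟨G, hG⟩ := exists_boundedContinuous_eqOn_isCompact hK hF
    refine (ProbabilityMeasure.continuous_integral_boundedContinuousFunction
      G).continuousOn.congr ?_
    intro π hπ
    refine integral_congr_ae ?_
    filter_upwards [hae π hπ] with p hp using (hG p hp).symm
  have hmarg : ∀ (f : ℝ × ℝ × ℝ → ℝ) (hf : Continuous f) (μ : Measure ℝ),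
      IsProbabilityMeasure μ → IsClosed {π : ProbabilityMeasure (ℝ × ℝ × ℝ) |
        (π : Measure (ℝ × ℝ × ℝ)).map f = μ} := by
    intro f hf μ hμ
    have : {π : ProbabilityMeasure (ℝ × ℝ × ℝ) | (π : Measure (ℝ × ℝ × ℝ)).map f = μ} =
        (fun π => ProbabilityMeasure.map π hf.measurable.aemeasurable) ⁻¹'
          {(⟨μ, hμ⟩ : ProbabilityMeasure ℝ)} := by
      ext π
      exact ⟨fun h => Subtype.ext h, fun h => congrArg Subtype.val h⟩
    rw [this]
    exact isClosed_singleton.preimage (ProbabilityMeasure.continuous_map hf)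
  have hclC : IsClosed (Couplings μX μY μZ) :=
    (hmarg _ (by fun_prop) μX inferInstance).inter
      ((hmarg _ (by fun_prop) μY inferInstance).inter (hmarg _ (by fun_prop) μZ inferInstance))
  have htight : IsTightMeasureSet
      {((μ : ProbabilityMeasure (ℝ × ℝ × ℝ)) : Measure (ℝ × ℝ × ℝ)) | μ ∈ Couplings μX μY μZ} := by
    rw [isTightMeasureSet_iff_exists_isCompact_measure_compl_le]
    rintro ε -
    refine ⟨_, hK, ?_⟩
    rintro _ ⟨π, hπ, rfl⟩
    have h0 : (π : Measure (ℝ × ℝ × ℝ)) (X ×ˢ Y ×ˢ Z)ᶜ = 0 := hae π hπ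
    rw [h0]
    exact zero_le
  -- Prokhorov: a single compact set carries every coupling.
  have hcomp : IsCompact (Couplings μX μY μZ) := by
    have := isCompact_closure_of_isTightMeasureSet htight
    rwa [hclC.closure_eq] at this
  have hzero : ∀ F : ℝ × ℝ × ℝ → ℝ, Continuous F → IsClosed (Couplings μX μY μZ ∩
      {π | ∫ p, F p ∂(π : Measure (ℝ × ℝ × ℝ)) = 0}) := fun F hF =>
    (hcont F hF).preimage_isClosed_of_isClosed hclC isClosed_singleton
  set S : Set (ProbabilityMeasure (ℝ × ℝ × ℝ)) :=
    {π | π ∈ Couplings μX μY μZ ∧ MartingaleTests (π : Measure (ℝ × ℝ × ℝ))} with hS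
  -- The test integrands are unbounded, so their integrals are known to be continuous only on
  -- `Couplings`; each constraint is therefore intersected with it.
  have hScl : IsClosed S := by
    have e : S = Couplings μX μY μZ ∩
        ((⋂ (g : ℝ → ℝ) (_ : Continuous g), (Couplings μX μY μZ ∩
          {π | ∫ p, g p.1 * (p.2.1 - p.1) ∂(π : Measure (ℝ × ℝ × ℝ)) = 0})) ∩
        (⋂ (g : ℝ × ℝ → ℝ) (_ : Continuous g), (Couplings μX μY μZ ∩
          {π | ∫ p, g (p.1, p.2.1) * (p.2.2 - p.2.1) ∂(π : Measure (ℝ × ℝ × ℝ)) = 0}))) := by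
      ext π
      simp only [hS, MartingaleTests, mem_ofPred_eq, mem_inter_iff, mem_iInter]
      constructor
      · rintro ⟨h, h1, h2⟩
        exact ⟨h, fun g hg => ⟨h, h1 g hg⟩, fun g hg => ⟨h, h2 g hg⟩⟩
      · rintro ⟨h, h1, h2⟩
        exact ⟨h, fun g hg => (h1 g hg).2, fun g hg => (h2 g hg).2⟩
    rw [e]
    refine hclC.inter (IsClosed.inter ?_ ?_)
    · exact isClosed_iInter fun g => isClosed_iInter fun hg => hzero _ (by fun_prop)
    · exact isClosed_iInter fun g => isClosed_iInter fun hg => hzero _ (by fun_prop)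
  have hScomp : IsCompact S := hcomp.of_isClosed_subset hScl fun π hπ => hπ.1
  obtain ⟨π₀, h0, h0'⟩ := hne
  obtain ⟨π, hπ, hmin⟩ := hScomp.exists_isMinOn ⟨π₀, h0, h0'⟩
    ((hcont C hC).mono fun π hπ => hπ.1)
  exact ⟨π, hπ.1, hπ.2, fun π' h1 h2 => hmin ⟨h1, h2⟩⟩

/-! ### Extension of the cost and conclusion. -/

/-- Tietze extension. It supplies globally continuous costs for the integrals, while the
Spence–Mirrlees condition stays on the original `c₃`, whose values agree on `X ×ˢ Z`. -/
theorem exists_continuous_eqOn_isCompact {α : Type*} [TopologicalSpace α] [T2Space α]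
    [NormalSpace α] {K : Set α} (hK : IsCompact K) {f : α → ℝ} (hf : ContinuousOn f K) :
    ∃ g : α → ℝ, Continuous g ∧ ∀ x ∈ K, g x = f x := by
  obtain ⟨g, hg⟩ := ContinuousMap.exists_restrict_eq hK.isClosed
    (⟨K.domRestrict f, hf.domRestrict⟩ : C(K, ℝ))
  refine ⟨g, g.continuous, fun x hx => ?_⟩
  exact congrArg (fun φ : C(K, ℝ) => φ ⟨x, hx⟩) hg

theorem isOptimalMOT_congr {μX μY μZ : Measure ℝ} {X Y Z : Set ℝ} (hX : MeasurableSet X)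
    (hY : MeasurableSet Y) (hZ : MeasurableSet Z) (hμX : μX Xᶜ = 0) (hμY : μY Yᶜ = 0)
    (hμZ : μZ Zᶜ = 0) {c c' : ℝ → ℝ → ℝ → ℝ}
    (h : ∀ x ∈ X, ∀ y ∈ Y, ∀ z ∈ Z, c x y z = c' x y z) (π : ProbabilityMeasure (ℝ × ℝ × ℝ)) :
    IsOptimalMOT c μX μY μZ π ↔ IsOptimalMOT c' μX μY μZ π := by
  have key : ∀ π ∈ MartingaleCouplings μX μY μZ,
      ∫ p, c p.1 p.2.1 p.2.2 ∂(π : Measure (ℝ × ℝ × ℝ)) =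
        ∫ p, c' p.1 p.2.1 p.2.2 ∂(π : Measure (ℝ × ℝ × ℝ)) := by
    intro π hπ
    refine integral_congr_ae ?_
    filter_upwards [Couplings.ae_mem hπ.1 hX hY hZ hμX hμY hμZ] with p hp
    exact h _ hp.1 _ hp.2.1 _ hp.2.2
  refine and_congr_right fun hπ => forall_congr' fun π' => forall_congr' fun hπ' => ?_
  rw [key π hπ, key π' hπ']

theorem mainTheorem4
    (μX μY μZ : Measure ℝ)
    [IsProbabilityMeasure μX] [IsProbabilityMeasure μY] [IsProbabilityMeasure μZ]
    (hXY : ConvexOrder μX μY) (hYZ : ConvexOrder μY μZ)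
    -- the marginals live on the compact sets `X`, `Y`, `Z`
    (X Y Z : Set ℝ)
    (xlo xhi : ℝ) (hX : X = Icc xlo xhi) (hμX : μX Xᶜ = 0)
    (hμX_atoms : ∀ x : ℝ, μX {x} = 0)
    (hY : IsCompact Y) (a₁ a₂ : ℝ≥0) (y₁ y₂ : ℝ) (hy₁ : y₁ ∈ Y) (hy₂ : y₂ ∈ Y)
    (hμY : μY = a₁ • Measure.dirac y₁ + a₂ • Measure.dirac y₂)
    (zmlo zmhi zplo zphi : ℝ) (hZ : Z = Icc zmlo zmhi ∪ Icc zplo zphi) (hμZ : μZ Zᶜ = 0)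
    (hzy : zmhi < y₁) (hyy : y₁ < y₂) (hyz : y₂ < zplo)
    -- the cost
    (c₁ c₂ c₃ : ℝ → ℝ → ℝ)
    (hc₁ : ContinuousOn (fun p : ℝ × ℝ => c₁ p.1 p.2) (X ×ˢ Y))
    (hc₂ : ContinuousOn (fun p : ℝ × ℝ => c₂ p.1 p.2) (Y ×ˢ Z))
    (hc₃ : ContinuousOn (fun p : ℝ × ℝ => c₃ p.1 p.2) (X ×ˢ Z))
    (hSM : MartingaleSpenceMirrlees X Z c₃) :
    ∃! π : ProbabilityMeasure (ℝ × ℝ × ℝ),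
      IsOptimalMOT (fun x y z => c₁ x y + c₂ y z + c₃ x z) μX μY μZ π := by
  have hXc : IsCompact X := hX ▸ isCompact_Icc
  have hZc : IsCompact Z := hZ ▸ isCompact_Icc.union isCompact_Icc
  have hpair : μY {y₁, y₂}ᶜ = 0 := by
    rw [hμY]
    simp
  have hμYc : μY Yᶜ = 0 := measure_mono_null (compl_subset_compl.2 (by
    rintro y (rfl | rfl)
    · exact hy₁
    · exact hy₂)) hpair
  have ha : a₁ + a₂ = 1 := by
    have h1 : μY univ = 1 := measure_univ
    rw [hμY, Measure.add_apply, Measure.smul_apply, Measure.smul_apply, measure_univ, measure_univ,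
      ← add_smul, ENNReal.smul_def, smul_eq_mul, mul_one] at h1
    exact_mod_cast h1
  have hmeanY : ∫ y, y ∂μY = a₁ * y₁ + a₂ * y₂ := by
    have hi : ∀ y : ℝ, Integrable (fun t : ℝ => t) (Measure.dirac y) := fun y =>
      integrable_dirac (by simp)
    rw [hμY, integral_add_measure (hi y₁).smul_measure_nnreal (hi y₂).smul_measure_nnreal,
      integral_smul_nnreal_measure, integral_smul_nnreal_measure, integral_dirac, integral_dirac]
    simp [NNReal.smul_def]
  obtain ⟨C₁, hC₁, e₁⟩ := exists_continuous_eqOn_isCompact (hXc.prod hY) hc₁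
  obtain ⟨C₂, hC₂, e₂⟩ := exists_continuous_eqOn_isCompact (hY.prod hZc) hc₂
  obtain ⟨C₃, hC₃, e₃⟩ := exists_continuous_eqOn_isCompact (hXc.prod hZc) hc₃
  have hiff := isOptimalMOT_congr hXc.measurableSet hY.measurableSet hZc.measurableSet hμX hμYc hμZ
    (c := fun x y z => c₁ x y + c₂ y z + c₃ x z)
    (c' := fun x y z => C₁ (x, y) + C₂ (y, z) + C₃ (x, z)) (fun x hx y hy z hz => by
      rw [e₁ (x, y) ⟨hx, hy⟩, e₂ (y, z) ⟨hy, hz⟩, e₃ (x, z) ⟨hx, hz⟩])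
  have hmem := mem_martingaleCouplings_iff hXc hY hZc hμX hμYc hμZ
  obtain ⟨ζ₁, ζ₂, pζ₁, pζ₂, aζ₁, aζ₂, mζ₁, mζ₂, hsum⟩ := exists_splitting_of_gap μZ (hZ ▸ hμZ) hzy
    hyy hyz a₁ a₂ ha (hYZ.integral_id_eq.symm.trans hmeanY)
  have hne := exists_martingale_coupling hXc hμX hZc hμZ hyy hμY ha
    (hXY.ae_mem_Icc hXc hμX hyy.le hpair) (hXY.integral_id_eq.trans hmeanY) aζ₁ aζ₂ mζ₁ mζ₂ hsum
  obtain ⟨π, hπ, hM, hmin⟩ := exists_optimal hXc hY hZc hμX hμYc hμZ hne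
    (C := fun p => C₁ (p.1, p.2.1) + C₂ (p.2.1, p.2.2) + C₃ (p.1, p.2.2)) (by fun_prop)
  refine existsUnique_of_exists_of_unique ⟨π, (hiff π).2 ⟨(hmem π).2 ⟨hπ, hM⟩, ?_⟩⟩ ?_
  · intro π' hπ'
    exact hmin π' ((hmem π').1 hπ').1 ((hmem π').1 hπ').2
  · intro π π' ho ho'
    subst hX
    exact eq_of_optimal hY hZc hμX hμYc hμZ hμX_atoms hyy hpair hC₁ hC₂ hC₃
      (fun x hx z hz => e₃ (x, z) ⟨hx, hz⟩) hSM ((hiff π).1 ho) ((hiff π').1 ho')
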